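/- Let $k$ be a field of characteristic $0$, and let $G=\langle n_1,n_2,n_3\rangle$ be a numerical semigroup minimally generated by positive integers $n_1<n_2<n_3$ with $\gcd(n_1,n_2,n_3)=1$. Let $R=k[[t^{n_1},t^{n_2},t^{n_3}]]\subseteq k[[t]]$ be the associated numerical semigroup ring, with maximal ideal $\mathfrak m$, and let $S=k[[x_1,x_2,x_3]]$, with maximal ideal $\mathfrak n$, map onto $R$ by $x_i\mapsto t^{n_i}$. The initial form ideal $I^*$ of the kernel $I$ of this surjection is the kernel of the natural map $\operatorname{gr}_{\mathfrak n}(S)\to\operatorname{gr}_{\mathfrak m}(R)$ of associated graded rings. Let $\mathcal M$ be the homogeneous maximal ideal of $A=\operatorname{gr}_{\mathfrak m}(R)$; the ring $A$ is called Buchsbaum if $\mathcal M\cdot H^0_{\mathcal M}(A)=0$, where $H^0_{\mathcal M}(A)=\{a\in A : \mathcal M^N a=0 \text{ for some } N\}$. Then: 1. If $\operatorname{gr}_{\mathfrak m}(R)$ is Buchsbaum, then $I^*$ can be generated by $4$ elements. 2. If $R$ is Gorenstein, then $\operatorname{gr}_{\mathfrak m}(R)$ is Cohen–Macaulay if and only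 if it is Buchsbaum. -/

import Mathlib

open Polynomial in
/-- The ring homomorphism `A[It] → B[Jt]` of Rees algebras induced by a ring homomorphism
`f : A → B` with `f(I) ⊆ J`: apply `f` to every coefficient. -/
noncomputable def reesAlgebraMap {A B : Type*} [CommRing A] [CommRing B] (f : A →+* B)
    (I : Ideal A) (J : Ideal B) (h : I.map f ≤ J) : reesAlgebra I →+* reesAlgebra J :=
  ((Polynomial.mapRingHom f).comp (reesAlgebra I).val.toRingHom).codRestrict (reesAlgebra J)
    (fun p => by
      rw [mem_reesAlgebra_iff]
      intro i
      have hp := (mem_reesAlgebra_iff I p.1).1 p.2 i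
      have h1 : f (p.1.coeff i) ∈ (I ^ i).map f := Ideal.mem_map_of_mem f hp
      rw [Ideal.map_pow] at h1
      have h2 := Ideal.pow_right_mono h i h1
      simpa using h2)

/-- The associated graded ring `gr_I(A) = ⨁ₙ Iⁿ / Iⁿ⁺¹`, realised as `A[It] / I · A[It]`. -/
abbrev AssocGraded {A : Type*} [CommRing A] (I : Ideal A) : Type _ :=
  reesAlgebra I ⧸ I.map (algebraMap A (reesAlgebra I))

/-- The natural map `gr_I(A) → gr_J(B)` induced by `f : A → B` with `f(I) ⊆ J`. -/
noncomputable def assocGradedMap {A B : Type*} [CommRing A] [CommRing B] (f : A →+* B)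
    (I : Ideal A) (J : Ideal B) (h : I.map f ≤ J) : AssocGraded I →+* AssocGraded J :=
  Ideal.quotientMap _ (reesAlgebraMap f I J h) (by
    rw [Ideal.map_le_iff_le_comap]
    intro a ha
    rw [Ideal.mem_comap, Ideal.mem_comap]
    have h1 : reesAlgebraMap f I J h (algebraMap A (reesAlgebra I) a)
        = algebraMap B (reesAlgebra J) (f a) := by
      apply Subtype.ext
      change Polynomial.map f (Polynomial.C a) = Polynomial.C (f a)
      simp
    rw [h1]
    exact Ideal.mem_map_of_mem _ (h (Ideal.mem_map_of_mem f ha)))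

/-- The homogeneous maximal ideal of `gr_𝔪(A)` for a local ring `(A, 𝔪)`: the image of the ideal
of those elements of the Rees algebra whose coefficient in degree `0` lies in `𝔪`, i.e. the ideal
of elements of `gr_𝔪(A)` whose component in `A / 𝔪` vanishes. -/
noncomputable def homogMaxIdeal (A : Type*) [CommRing A] [IsLocalRing A] :
    Ideal (AssocGraded (IsLocalRing.maximalIdeal A)) :=
  Ideal.map (Ideal.Quotient.mk _)
    (Ideal.comap
      (Polynomial.constantCoeff.comp (reesAlgebra (IsLocalRing.maximalIdeal A)).val.toRingHom)
      (IsLocalRing.maximalIdeal A))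

/-- The `0`-th local cohomology `H⁰_M(A) = {a ∈ A | Mᴺ a = 0 for some N}`, an ideal of `A`. -/
def localCohomologyZero {A : Type*} [CommRing A] (M : Ideal A) : Ideal A where
  carrier := {a | ∃ N : ℕ, ∀ r ∈ M ^ N, r * a = 0}
  zero_mem' := ⟨0, fun r _ => mul_zero r⟩
  add_mem' := by
    rintro a b ⟨N, hN⟩ ⟨N', hN'⟩
    refine ⟨max N N', fun r hr => ?_⟩
    rw [mul_add, hN r (Ideal.pow_le_pow_right (le_max_left N N') hr),
      hN' r (Ideal.pow_le_pow_right (le_max_right N N') hr), add_zero]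
  smul_mem' := by
    rintro c a ⟨N, hN⟩
    refine ⟨N, fun r hr => ?_⟩
    rw [smul_eq_mul, mul_left_comm, hN r hr, mul_zero]

/-- A one-dimensional graded ring `A` with homogeneous maximal ideal `M` is `k`-Buchsbaum if
`Mᵏ · H⁰_M(A) = 0`. -/
def IsKBuchsbaum {A : Type*} [CommRing A] (M : Ideal A) (k : ℕ) : Prop :=
  M ^ k * localCohomologyZero M = ⊥

/-- Buchsbaum means `1`-Buchsbaum. -/
def IsBuchsbaum {A : Type*} [CommRing A] (M : Ideal A) : Prop :=
  IsKBuchsbaum M 1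

/-- `rs` is a regular sequence in the maximal ideal of the local ring `A` whose length is the Krull
dimension of `A`. -/
def IsMaxRegularSeq (A : Type*) [CommRing A] [IsLocalRing A] (rs : List A) : Prop :=
  (∀ r ∈ rs, r ∈ IsLocalRing.maximalIdeal A) ∧ RingTheory.Sequence.IsRegular A rs ∧
    ((rs.length : ℕ) : WithBot ℕ∞) = ringKrullDim A

/-- A local ring is Cohen–Macaulay if it is Noetherian and its depth equals its dimension. -/
def IsCohenMacaulayLocalRing (A : Type*) [CommRing A] [IsLocalRing A] : Prop :=
  IsNoetherianRing A ∧ ∃ rs : List A, IsMaxRegularSeq A rs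

/-- A ring is Cohen–Macaulay if it is Noetherian and all its localizations at maximal ideals are
Cohen–Macaulay local rings. -/
def IsCohenMacaulayRing (A : Type*) [CommRing A] : Prop :=
  IsNoetherianRing A ∧
    ∀ (P : Ideal A) [P.IsMaximal], IsCohenMacaulayLocalRing (Localization.AtPrime P)

/-- A local ring is Gorenstein if it is Noetherian and Cohen–Macaulay, and an ideal generated by a
regular sequence of length `dim A` is irreducible (not an intersection of two strictly larger
ideals), i.e. `A` is Cohen–Macaulay of type `1`. -/
def IsGorensteinLocalRing (A : Type*) [CommRing A] [IsLocalRing A] : Prop :=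
  IsNoetherianRing A ∧ ∃ rs : List A, IsMaxRegularSeq A rs ∧ InfIrred (Ideal.ofList rs)

section NumericalSemigroupRing

variable (k : Type*) [Field k] {d : ℕ} (n : Fin d → ℕ+)

theorem hasSubst_X_pow :
    MvPowerSeries.HasSubst (fun i : Fin d => (PowerSeries.X ^ (n i : ℕ) : PowerSeries k)) :=
  MvPowerSeries.hasSubst_of_constantCoeff_zero fun i => by
    change PowerSeries.constantCoeff (PowerSeries.X ^ (n i : ℕ) : PowerSeries k) = 0
    simp

/-- The `k`-algebra homomorphism `k[[x₁, …, x_d]] → k[[t]]`, `f(x₁, …, x_d) ↦ f(t^{n₁}, …, t^{n_d})`. -/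
noncomputable def paramHom : MvPowerSeries (Fin d) k →ₐ[k] PowerSeries k :=
  MvPowerSeries.substAlgHom (hasSubst_X_pow k n)

/-- The numerical semigroup ring `R = k[[t^{n₁}, …, t^{n_d}]]`, a subring of `k[[t]]`. -/
noncomputable abbrev NumSemigroupRing : Subalgebra k (PowerSeries k) :=
  (paramHom k n).range

/-- The surjection `S = k[[x₁, …, x_d]] → R`, `x_i ↦ t^{n_i}`. -/
noncomputable abbrev presentation : MvPowerSeries (Fin d) k →+* NumSemigroupRing k n :=
  (paramHom k n).rangeRestrict.toRingHom

theorem presentation_surjective : Function.Surjective (presentation k n) :=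
  (paramHom k n).rangeRestrict_surjective

instance numSemigroupRing_isLocalRing : IsLocalRing (NumSemigroupRing k n) :=
  IsLocalRing.of_surjective' (presentation k n) (presentation_surjective k n)

theorem presentation_map_maximalIdeal_le :
    (IsLocalRing.maximalIdeal (MvPowerSeries (Fin d) k)).map (presentation k n) ≤
      IsLocalRing.maximalIdeal (NumSemigroupRing k n) :=
  haveI := IsLocalHom.of_surjective (presentation k n) (presentation_surjective k n)
  IsLocalRing.map_maximalIdeal_le (presentation k n)

/-- The tangent cone `gr_𝔪(R)`. -/
abbrev TangentCone : Type _ :=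
  AssocGraded (IsLocalRing.maximalIdeal (NumSemigroupRing k n))

/-- The initial form ideal `I*`: the kernel of the natural map `gr_𝔫(S) → gr_𝔪(R)`. -/
noncomputable def initialFormIdeal :
    Ideal (AssocGraded (IsLocalRing.maximalIdeal (MvPowerSeries (Fin d) k))) :=
  RingHom.ker (assocGradedMap (presentation k n) _ _ (presentation_map_maximalIdeal_le k n))

end NumericalSemigroupRing

/-! Write x < y < z for the generators. The power `𝔪^e` consists of the series supported on
semigroup elements having a factorization of length at least e (`maximalIdeal_pow_eq_orderIdeal`).
Hence `gr_𝔪(R)` is k[X,Y,Z]/K, where f lies in K exactly when, in every bidegree (degree e, weight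
s), either the coefficients of f sum to 0 or s has a factorization longer than e
(`tangentConeEval_eq_zero_iff`). Both assertions become statements about lengths of factorizations.
As yx = xy with x < y, and likewise for z, the classes of Y and Z are nilpotent, so X alone decides
questions of depth.

Suppose X is a nonzerodivisor (`OrderRegular`). Modulo X only monomials in Y and Z matter, and the
nonstandard ones have at most three minimal elements: one on each axis, and at most one off the
axes, because such an element satisfies qy + rz = px and two relations of this kind are
incompatible. Each lifts to one relation, so K has three generators. Also `gr_𝔪(R)` is
Cohen–Macaulay, since every maximal ideal is minimal over p(X) for some nonzero p, and p(X) is a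
nonzerodivisor.

Suppose X is a zero divisor and the cone is Buchsbaum. A monomial that X kills must be a power
Z^(m+1), with x + (m+1)z = by. Since Y and Z kill it too, y + z = ax
(`OrderBuchsbaum.exceptionalRelations`). These relations give an explicit monomial basis, and K is
generated by YZ, XZ^(m+1), Z^(m+2) and one element with leading term Y^(b+1): four generators.

In this exceptional case (b-1)y - x and (m+1)z - x are distinct pseudo-Frobenius numbers. In a
Gorenstein R there cannot be two, because distinct f, f' would write (r) as the intersection of the
larger ideals (r, t^f r) and (r, t^f' r). So a Gorenstein R with Buchsbaum tangent cone falls in the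
regular case. Conversely, Cohen–Macaulayness makes `H⁰_M` vanish. -/

/-! ### The semigroup ring inside k[[t]] and its 𝔪-adic filtration. -/

section PowerSeriesDescription

variable (k : Type*) [Field k] {d : ℕ} (n : Fin d → ℕ+)

/-- The value of an exponent vector under `x_i ↦ n_i`. -/
noncomputable def expWeight : (Fin d →₀ ℕ) →+ ℕ :=
  Finsupp.weight fun i => (n i : ℕ)

theorem expWeight_single (i : Fin d) (c : ℕ) :
    expWeight n (Finsupp.single i c) = c * n i := by
  simp [expWeight, Finsupp.weight_single]

theorem expWeight_eq_sum (a : Fin d →₀ ℕ) : expWeight n a = ∑ i, a i * n i := by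
  simp [expWeight, Finsupp.weight_eq_sum]

/-- `s` has a factorization of length at least `e` in the semigroup generated by the `n_i`. -/
def LongFactorization (s e : ℕ) : Prop :=
  ∃ a : Fin d →₀ ℕ, expWeight n a = s ∧ e ≤ a.degree

variable {n}

theorem LongFactorization.mono {s e e' : ℕ} (h : LongFactorization n s e) (he : e' ≤ e) :
    LongFactorization n s e' :=
  let ⟨a, h1, h2⟩ := h
  ⟨a, h1, he.trans h2⟩

theorem LongFactorization.add {s e s' e' : ℕ} (h : LongFactorization n s e)
    (h' : LongFactorization n s' e') : LongFactorization n (s + s') (e + e') := by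
  obtain ⟨a, h1, h2⟩ := h
  obtain ⟨b, h3, h4⟩ := h'
  exact ⟨a + b, by simp [h1, h3], by simp only [map_add]; omega⟩

theorem longFactorization_gen (i : Fin d) : LongFactorization n (n i) 1 :=
  ⟨Finsupp.single i 1, by simp [expWeight_single], by simp⟩

theorem longFactorization_zero : LongFactorization n 0 0 :=
  ⟨0, by simp, by simp⟩

theorem degree_le_expWeight (a : Fin d →₀ ℕ) : a.degree ≤ expWeight n a := by
  rw [expWeight_eq_sum, Finsupp.degree_eq_sum]
  exact Finset.sum_le_sum fun i _ => Nat.le_mul_of_pos_right _ (n i).pos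

theorem LongFactorization.le {s e : ℕ} (h : LongFactorization n s e) : e ≤ s := by
  obtain ⟨a, rfl, h2⟩ := h
  exact h2.trans (degree_le_expWeight a)

theorem LongFactorization.exists_sub {s e : ℕ} (h : LongFactorization n s (e + 1)) :
    ∃ i, (n i : ℕ) ≤ s ∧ LongFactorization n (s - n i) e := by
  obtain ⟨a, rfl, h2⟩ := h
  have ha : a ≠ 0 := by
    rintro rfl
    simp at h2
  obtain ⟨i, hi⟩ := Finsupp.ne_iff.1 ha
  have hle : Finsupp.single i 1 ≤ a := by
    rw [Finsupp.single_le_iff]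
    exact Nat.one_le_iff_ne_zero.2 hi
  obtain ⟨b, rfl⟩ := exists_add_of_le hle
  refine ⟨i, ?_, b, ?_, ?_⟩
  · simp [expWeight_single]
  · simp [expWeight_single]
  · simp only [map_add, Finsupp.degree_single] at h2
    omega

variable (n)

theorem coeff_paramHom (f : MvPowerSeries (Fin d) k) (s : ℕ) :
    PowerSeries.coeff s (paramHom k n f) =
      ∑ᶠ a : Fin d →₀ ℕ, if expWeight n a = s then MvPowerSeries.coeff a f else 0 := by
  have h1 : paramHom k n f = MvPowerSeries.subst
      (fun i : Fin d => (PowerSeries.X ^ (n i : ℕ) : PowerSeries k)) f :=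
    MvPowerSeries.substAlgHom_apply (hasSubst_X_pow k n) f
  rw [h1, PowerSeries.coeff, MvPowerSeries.coeff_subst (hasSubst_X_pow k n)]
  refine finsum_congr fun a => ?_
  have h2 : (a.prod fun i e => ((PowerSeries.X ^ (n i : ℕ) : PowerSeries k)) ^ e)
      = PowerSeries.X ^ expWeight n a := by
    rw [expWeight_eq_sum, Finsupp.prod_fintype _ _ (by simp), ← Finset.prod_pow_eq_pow_sum]
    exact Finset.prod_congr rfl fun i _ => by rw [← pow_mul, mul_comm]
  rw [h2]
  change _ • PowerSeries.coeff s (PowerSeries.X ^ expWeight n a : PowerSeries k) = _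
  rw [PowerSeries.coeff_X_pow]
  by_cases h3 : expWeight n a = s
  · rw [if_pos h3.symm, if_pos h3, smul_eq_mul, mul_one]
  · rw [if_neg (Ne.symm h3), if_neg h3, smul_zero]

/-- For the converse, fix one factorization σ(s) for each s in the support of f and put the whole
coefficient of t^s on that single monomial. -/
theorem mem_numSemigroupRing_iff (f : PowerSeries k) :
    f ∈ NumSemigroupRing k n ↔
      ∀ s, PowerSeries.coeff s f ≠ 0 → LongFactorization n s 0 := by
  classical
  constructor
  · rintro ⟨F, rfl⟩ s hs
    have hs' : PowerSeries.coeff s (paramHom k n F) ≠ 0 := hs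
    rw [coeff_paramHom] at hs'
    obtain ⟨a, ha⟩ : ∃ a, (if expWeight n a = s then MvPowerSeries.coeff a F else 0) ≠ 0 := by
      by_contra! h
      exact hs' (finsum_eq_zero_of_forall_eq_zero h)
    refine ⟨a, ?_, Nat.zero_le _⟩
    by_contra h
    exact ha (if_neg h)
  · intro hf
    choose! σ hσ _ using hf
    obtain ⟨F, hF⟩ : ∃ F : MvPowerSeries (Fin d) k, ∀ a, MvPowerSeries.coeff a F =
        if σ (expWeight n a) = a then PowerSeries.coeff (expWeight n a) f else 0 :=
      ⟨fun a => if σ (expWeight n a) = a then PowerSeries.coeff (expWeight n a) f else 0,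
        fun _ => rfl⟩
    refine ⟨F, ?_⟩
    ext s
    change PowerSeries.coeff s (paramHom k n F) = _
    rw [coeff_paramHom]
    simp only [hF]
    by_cases hs : PowerSeries.coeff s f = 0
    · rw [hs]
      refine finsum_eq_zero_of_forall_eq_zero fun a => ?_
      split_ifs with h
      · rw [h, hs]
      · rfl
      · rfl
    · rw [finsum_eq_single _ (σ s)]
      · rw [if_pos (hσ s hs), hσ s hs, if_pos rfl]
      · intro a ha
        by_cases h : expWeight n a = s
        · rw [if_pos h, h, if_neg (Ne.symm ha)]
        · rw [if_neg h]

variable {n}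

/-- A monomial `t^s` with `s` in the semigroup, as an element of the semigroup ring. -/
noncomputable def semigroupMonomial (s : ℕ) (h : LongFactorization n s 0) :
    NumSemigroupRing k n :=
  ⟨PowerSeries.X ^ s, (mem_numSemigroupRing_iff k n _).2 fun u hu => by
    rw [PowerSeries.coeff_X_pow] at hu
    have : u = s := by
      by_contra h'
      exact hu (if_neg h')
    exact this ▸ h⟩

variable (n)

/-- The generator `t^{n_i}` of the semigroup ring. -/
noncomputable def semigroupGen (i : Fin d) : NumSemigroupRing k n :=
  semigroupMonomial k (n i) ((longFactorization_gen i).mono (Nat.zero_le _))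

theorem presentation_X (i : Fin d) :
    presentation k n (MvPowerSeries.X i) = semigroupGen k n i := by
  apply Subtype.ext
  exact MvPowerSeries.substAlgHom_X (hasSubst_X_pow k n) i

theorem mem_maximalIdeal_iff_constantCoeff (f : MvPowerSeries (Fin d) k) :
    f ∈ IsLocalRing.maximalIdeal (MvPowerSeries (Fin d) k) ↔
      MvPowerSeries.constantCoeff f = 0 := by
  rw [IsLocalRing.mem_maximalIdeal, mem_nonunits_iff, MvPowerSeries.isUnit_iff_constantCoeff,
    isUnit_iff_ne_zero, not_not]

theorem constantCoeff_paramHom (f : MvPowerSeries (Fin d) k) :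
    PowerSeries.coeff 0 (paramHom k n f) = MvPowerSeries.constantCoeff f := by
  rw [coeff_paramHom, finsum_eq_single _ 0]
  · simp
  · intro a ha
    rw [if_neg]
    intro h
    have := degree_le_expWeight (n := n) a
    rw [h] at this
    exact ha ((Finsupp.degree_eq_zero_iff a).1 (Nat.le_zero.1 this))

theorem mem_maximalIdeal_numSemigroupRing_iff (f : NumSemigroupRing k n) :
    f ∈ IsLocalRing.maximalIdeal (NumSemigroupRing k n) ↔
      PowerSeries.coeff 0 (f : PowerSeries k) = 0 := by
  obtain ⟨F, rfl⟩ := presentation_surjective k n f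
  have := IsLocalHom.of_surjective (presentation k n) (presentation_surjective k n)
  rw [IsLocalRing.mem_maximalIdeal, mem_nonunits_iff, isUnit_map_iff (presentation k n),
    ← mem_nonunits_iff, ← IsLocalRing.mem_maximalIdeal, mem_maximalIdeal_iff_constantCoeff,
    ← constantCoeff_paramHom k n]
  rfl

/-- The ideal of elements of the semigroup ring supported on elements with a factorization of
length at least `e`. -/
def orderIdeal (e : ℕ) : Ideal (NumSemigroupRing k n) where
  carrier := {f | ∀ s, PowerSeries.coeff s (f : PowerSeries k) ≠ 0 → LongFactorization n s e}
  zero_mem' := by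
    intro s hs
    simp at hs
  add_mem' := by
    intro f g hf hg s hs
    by_cases h : PowerSeries.coeff s (f : PowerSeries k) = 0
    · refine hg s fun h' => hs ?_
      change PowerSeries.coeff s ((f : PowerSeries k) + (g : PowerSeries k)) = 0
      rw [map_add, h, h', add_zero]
    · exact hf s h
  smul_mem' := by
    intro c f hf s hs
    change PowerSeries.coeff s ((c : PowerSeries k) * (f : PowerSeries k)) ≠ 0 at hs
    rw [PowerSeries.coeff_mul] at hs
    obtain ⟨⟨u, v⟩, huv, h⟩ := Finset.exists_ne_zero_of_sum_ne_zero hs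
    rw [Finset.HasAntidiagonal.mem_antidiagonal] at huv
    have h1 := (mem_numSemigroupRing_iff k n _).1 c.2 u (left_ne_zero_of_mul h)
    have h2 := (h1.add (hf v (right_ne_zero_of_mul h)))
    simpa [← huv] using h2

theorem mem_orderIdeal (e : ℕ) (f : NumSemigroupRing k n) : f ∈ orderIdeal k n e ↔
    ∀ s, PowerSeries.coeff s (f : PowerSeries k) ≠ 0 → LongFactorization n s e :=
  Iff.rfl

theorem orderIdeal_zero : orderIdeal k n 0 = ⊤ :=
  Ideal.eq_top_iff_one _ |>.2 fun s hs =>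
    (mem_numSemigroupRing_iff k n _).1 (1 : NumSemigroupRing k n).2 s hs

theorem orderIdeal_one :
    orderIdeal k n 1 = IsLocalRing.maximalIdeal (NumSemigroupRing k n) := by
  ext f
  rw [mem_maximalIdeal_numSemigroupRing_iff, mem_orderIdeal]
  constructor
  · intro h
    by_contra h0
    exact absurd (h 0 h0).le (by norm_num)
  · intro h s hs
    obtain ⟨a, ha, _⟩ := (mem_numSemigroupRing_iff k n _).1 f.2 s hs
    refine ⟨a, ha, Nat.one_le_iff_ne_zero.2 fun h0 => hs ?_⟩
    rw [Finsupp.degree_eq_zero_iff] at h0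
    rw [← ha, h0, map_zero, h]

theorem semigroupGen_mem_orderIdeal (i : Fin d) : semigroupGen k n i ∈ orderIdeal k n 1 := by
  intro s hs
  change PowerSeries.coeff s (PowerSeries.X ^ (n i : ℕ)) ≠ 0 at hs
  rw [PowerSeries.coeff_X_pow] at hs
  have : s = n i := by
    by_contra h'
    exact hs (if_neg h')
  exact this ▸ longFactorization_gen i

theorem orderIdeal_mul_le (e e' : ℕ) :
    orderIdeal k n e * orderIdeal k n e' ≤ orderIdeal k n (e + e') := by
  rw [Ideal.mul_le]
  intro f hf g hg s hs
  change PowerSeries.coeff s ((f : PowerSeries k) * (g : PowerSeries k)) ≠ 0 at hs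
  rw [PowerSeries.coeff_mul] at hs
  obtain ⟨⟨u, v⟩, huv, h⟩ := Finset.exists_ne_zero_of_sum_ne_zero hs
  rw [Finset.HasAntidiagonal.mem_antidiagonal] at huv
  exact huv ▸ (hf u (left_ne_zero_of_mul h)).add (hg v (right_ne_zero_of_mul h))

/-- Each exponent s in the support has a generator that can be removed from a long factorization.
Sorting the terms of f by the chosen generator ι(s) writes f as a finite sum of t^(n_i) g_i, even
though f has infinitely many terms. -/
theorem orderIdeal_succ_le (e : ℕ) :
    orderIdeal k n (e + 1) ≤ Ideal.span (Set.range (semigroupGen k n)) * orderIdeal k n e := by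
  classical
  intro f hf
  by_cases h0 : f = 0
  · rw [h0]
    exact zero_mem _
  have hd : Nonempty (Fin d) := by
    by_contra hd
    refine h0 (Subtype.ext (PowerSeries.ext fun s => ?_))
    by_contra hs
    exact hd ⟨(hf s hs).exists_sub.choose⟩
  have hf' := fun s hs => (hf s hs).exists_sub
  choose! ι h1 h2 using hf'
  let g : Fin d → PowerSeries k := fun i => PowerSeries.mk fun u =>
    if ι (u + n i) = i then PowerSeries.coeff (u + n i) (f : PowerSeries k) else 0
  have hg : ∀ i u, PowerSeries.coeff u (g i) ≠ 0 → LongFactorization n u e := by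
    intro i u hu
    rw [PowerSeries.coeff_mk] at hu
    by_cases h : ι (u + n i) = i
    · rw [if_pos h] at hu
      have := h2 _ hu
      rwa [h, Nat.add_sub_cancel] at this
    · rw [if_neg h] at hu
      exact absurd rfl hu
  let G : Fin d → NumSemigroupRing k n := fun i =>
    ⟨g i, (mem_numSemigroupRing_iff k n _).2 fun u hu => (hg i u hu).mono (Nat.zero_le _)⟩
  have hfG : f = ∑ i, semigroupGen k n i * G i := by
    apply Subtype.ext
    ext s
    rw [AddSubmonoidClass.coe_finsetSum, map_sum]
    have h3 : ∀ i, PowerSeries.coeff s ((semigroupGen k n i * G i : NumSemigroupRing k n) :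
        PowerSeries k) = if i = ι s then PowerSeries.coeff s (f : PowerSeries k) else 0 := by
      intro i
      change PowerSeries.coeff s (PowerSeries.X ^ (n i : ℕ) * g i) = _
      rw [PowerSeries.coeff_X_pow_mul']
      by_cases hs : PowerSeries.coeff s (f : PowerSeries k) = 0
      · rw [hs, ite_self]
        split_ifs with h
        · rw [PowerSeries.coeff_mk, Nat.sub_add_cancel h, hs, ite_self]
        · rfl
      · by_cases hi : i = ι s
        · rw [if_pos hi, if_pos (hi ▸ h1 s hs), PowerSeries.coeff_mk,
            Nat.sub_add_cancel (hi ▸ h1 s hs), if_pos hi.symm]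
        · rw [if_neg hi]
          split_ifs with h
          · rw [PowerSeries.coeff_mk, Nat.sub_add_cancel h, if_neg (Ne.symm hi)]
          · rfl
    rw [Finset.sum_congr rfl fun i _ => h3 i, Finset.sum_ite_eq' Finset.univ (ι s),
      if_pos (Finset.mem_univ _)]
  rw [hfG]
  exact sum_mem fun i _ => Ideal.mul_mem_mul (Ideal.subset_span ⟨i, rfl⟩) (hg i)

theorem span_semigroupGen :
    Ideal.span (Set.range (semigroupGen k n)) =
      IsLocalRing.maximalIdeal (NumSemigroupRing k n) := by
  rw [← orderIdeal_one]
  apply le_antisymm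
  · rw [Ideal.span_le]
    rintro _ ⟨i, rfl⟩
    exact semigroupGen_mem_orderIdeal k n i
  · exact (orderIdeal_succ_le k n 0).trans Ideal.mul_le_left

/-- This turns the 𝔪-adic filtration into combinatorics of factorization lengths. -/
theorem maximalIdeal_pow_eq_orderIdeal (e : ℕ) :
    IsLocalRing.maximalIdeal (NumSemigroupRing k n) ^ e = orderIdeal k n e := by
  induction e with
  | zero => rw [pow_zero, Ideal.one_eq_top, orderIdeal_zero]
  | succ e ih =>
    rw [pow_succ', ih]
    apply le_antisymm
    · rw [← orderIdeal_one, add_comm e 1]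
      exact orderIdeal_mul_le k n 1 e
    · rw [← span_semigroupGen]
      exact orderIdeal_succ_le k n e

theorem span_X_eq_maximalIdeal :
    Ideal.span (Set.range (MvPowerSeries.X : Fin d → MvPowerSeries (Fin d) k)) =
      IsLocalRing.maximalIdeal (MvPowerSeries (Fin d) k) := by
  classical
  apply le_antisymm
  · rw [Ideal.span_le]
    rintro _ ⟨i, rfl⟩
    exact (mem_maximalIdeal_iff_constantCoeff k _).2 (MvPowerSeries.constantCoeff_X i)
  · intro f hf
    rw [mem_maximalIdeal_iff_constantCoeff] at hf
    by_cases hd : Nonempty (Fin d)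
    · have h1 : ∀ a : Fin d →₀ ℕ, a ≠ 0 → ∃ i, a i ≠ 0 := fun a ha => Finsupp.ne_iff.1 ha
      choose! ι hι using h1
      let g : Fin d → MvPowerSeries (Fin d) k := fun i a =>
        if i = ι a then MvPowerSeries.coeff a f else 0
      have hg : ∀ i a, MvPowerSeries.coeff a (g i) =
        if i = ι a then MvPowerSeries.coeff a f else 0 := fun _ _ => rfl
      have hfg : f = ∑ i, g i := by
        ext a
        rw [map_sum, Finset.sum_congr rfl fun i _ => hg i a, Finset.sum_ite_eq' Finset.univ (ι a),
          if_pos (Finset.mem_univ _)]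
      rw [hfg]
      refine sum_mem fun i _ => ?_
      have h2 : (MvPowerSeries.X i : MvPowerSeries (Fin d) k) ∣ g i := by
        rw [MvPowerSeries.X_dvd_iff]
        intro a ha
        rw [hg]
        split_ifs with h
        · by_cases ha0 : a = 0
          · rw [ha0, ← hf]
            rfl
          · exact absurd (h ▸ ha) (hι a ha0)
        · rfl
      exact Ideal.mem_of_dvd _ h2 (Ideal.subset_span ⟨i, rfl⟩)
    · have : f = 0 := by
        ext a
        have ha : a = 0 := Finsupp.ext fun i => absurd ⟨i⟩ hd
        rw [ha, map_zero, ← hf]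
        rfl
      rw [this]
      exact zero_mem _

end PowerSeriesDescription

/-! ### Associated graded rings as quotients of Rees algebras, and their presentations. -/

section AssociatedGraded

open Polynomial

variable {A : Type*} [CommRing A] (I : Ideal A)

/-- The elements of the Rees algebra whose `i`-th coefficient lies in `I ^ (i + 1)`. -/
def reesShiftIdeal : Ideal (reesAlgebra I) where
  carrier := {p | ∀ i, (p : A[X]).coeff i ∈ I ^ (i + 1)}
  zero_mem' := fun _ => zero_mem _
  add_mem' := by
    intro p q hp hq i
    change ((p : A[X]) + (q : A[X])).coeff i ∈ _
    rw [Polynomial.coeff_add]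
    exact add_mem (hp i) (hq i)
  smul_mem' := by
    intro c p hp i
    change ((c : A[X]) * (p : A[X])).coeff i ∈ _
    rw [Polynomial.coeff_mul]
    refine sum_mem fun uv huv => ?_
    rw [Finset.HasAntidiagonal.mem_antidiagonal] at huv
    rw [← huv, add_assoc, pow_add]
    exact Ideal.mul_mem_mul (c.2 _) (hp _)

variable {I}

/-- The homogeneous element `u T^i` of the Rees algebra. -/
noncomputable def reesMonomial (i : ℕ) (u : A) (hu : u ∈ I ^ i) : reesAlgebra I :=
  ⟨Polynomial.monomial i u, reesAlgebra.monomial_mem.2 hu⟩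

theorem reesMonomial_mem_map (i : ℕ) (u : A) (hu : u ∈ I ^ i) (hu' : u ∈ I ^ (i + 1)) :
    reesMonomial i u hu ∈ I.map (algebraMap A (reesAlgebra I)) := by
  rw [pow_succ'] at hu'
  induction hu' using Submodule.mul_induction_on' with
  | mem_mul_mem a ha v hv =>
    have : reesMonomial i (a * v) hu = algebraMap A (reesAlgebra I) a * reesMonomial i v hv :=
      Subtype.ext (Polynomial.C_mul_monomial (a := a) (b := v) (n := i)).symm
    rw [this]
    exact Ideal.mul_mem_right _ _ (Ideal.mem_map_of_mem _ ha)
  | add x hx y hy ihx ihy =>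
    have h1 : x ∈ I ^ i := Ideal.mul_le_right hx
    have h2 : y ∈ I ^ i := Ideal.mul_le_right hy
    have : reesMonomial i (x + y) hu = reesMonomial i x h1 + reesMonomial i y h2 :=
      Subtype.ext (map_add (Polynomial.monomial i) x y)
    rw [this]
    exact add_mem (ihx h1) (ihy h2)

theorem reesAlgebra_eq_sum (p : reesAlgebra I) :
    p = ∑ i ∈ (p : A[X]).support, reesMonomial i ((p : A[X]).coeff i) (p.2 i) := by
  apply Subtype.ext
  rw [AddSubmonoidClass.coe_finsetSum]
  exact Polynomial.as_sum_support _

/-- Makes vanishing in the associated graded ring a condition on each coefficient separately. -/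
theorem map_algebraMap_reesAlgebra :
    I.map (algebraMap A (reesAlgebra I)) = reesShiftIdeal I := by
  apply le_antisymm
  · rw [Ideal.map_le_iff_le_comap]
    intro a ha i
    change (Polynomial.C a).coeff i ∈ _
    rw [Polynomial.coeff_C]
    split_ifs with h
    · rw [h]
      simpa using ha
    · exact zero_mem _
  · intro p hp
    rw [reesAlgebra_eq_sum p]
    exact sum_mem fun i _ => reesMonomial_mem_map i _ _ (hp i)

variable (I)

section Eval

variable {k σ : Type*} [CommRing k] (c : k →+* A) (x : σ → A) (hx : ∀ i, x i ∈ I)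

/-- The homomorphism `k[X_i] → A[It]` sending `X_i` to `x_i t`. -/
noncomputable def reesEval : MvPolynomial σ k →+* reesAlgebra I :=
  MvPolynomial.eval₂Hom ((algebraMap A (reesAlgebra I)).comp c)
    fun i => reesMonomial 1 (x i) (by simpa using hx i)

/-- The homomorphism `k[X_i] → gr_I(A)` sending `X_i` to the class of `x_i` in degree `1`. -/
noncomputable def gradedEval : MvPolynomial σ k →+* AssocGraded I :=
  (Ideal.Quotient.mk _).comp (reesEval I c x hx)

theorem gradedEval_X (i : σ) : gradedEval I c x hx (MvPolynomial.X i) =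
    Ideal.Quotient.mk _ (reesMonomial 1 (x i) (by simpa using hx i)) := by
  simp [gradedEval, reesEval]

theorem gradedEval_C (r : k) : gradedEval I c x hx (MvPolynomial.C r) =
    Ideal.Quotient.mk _ (algebraMap A (reesAlgebra I) (c r)) := by
  simp [gradedEval, reesEval]

theorem reesEval_monomial (a : σ →₀ ℕ) (r : k) :
    (reesEval I c x hx (MvPolynomial.monomial a r) : A[X]) =
      Polynomial.monomial a.degree (c r * a.prod fun i e => x i ^ e) := by
  rw [reesEval, MvPolynomial.eval₂Hom_monomial]
  change Polynomial.C (c r) * (reesAlgebra I).val _ = _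
  rw [Finsupp.prod, map_prod, ← Polynomial.C_mul_monomial]
  congr 1
  have h : ∀ i ∈ a.support, (reesAlgebra I).val
      (reesMonomial 1 (x i) (by simpa using hx i) ^ a i) =
      Polynomial.C (x i ^ a i) * Polynomial.X ^ a i := by
    intro i _
    rw [map_pow]
    change (Polynomial.monomial 1 (x i)) ^ a i = _
    rw [← Polynomial.C_mul_X_eq_monomial, mul_pow, map_pow]
  rw [Finset.prod_congr rfl h, Finset.prod_mul_distrib, ← map_prod, Finset.prod_pow_eq_pow_sum,
    ← Finsupp.degree_apply, Polynomial.C_mul_X_pow_eq_monomial]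
  rfl

/-- The graded ring is generated in degrees 0 and 1: scalars exhaust degree 0, the `x i` span degree
1 over it, and each higher piece is a sum of products of lower ones. -/
theorem gradedEval_surjective (hspan : Ideal.span (Set.range x) = I)
    (hres : ∀ u : A, ∃ r : k, u - c r ∈ I) : Function.Surjective (gradedEval I c x hx) := by
  have h0 : ∀ u : A, Ideal.Quotient.mk (I.map (algebraMap A (reesAlgebra I)))
      (algebraMap A (reesAlgebra I) u) ∈ (gradedEval I c x hx).range := by
    intro u
    obtain ⟨r, hr⟩ := hres u
    refine ⟨MvPolynomial.C r, ?_⟩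
    rw [gradedEval_C, eq_comm, Ideal.Quotient.eq, ← map_sub]
    exact Ideal.mem_map_of_mem _ hr
  have h1 : ∀ u : A, ∀ hu : u ∈ I ^ 1,
      Ideal.Quotient.mk (I.map (algebraMap A (reesAlgebra I))) (reesMonomial 1 u hu) ∈
        (gradedEval I c x hx).range := by
    intro u hu
    have hu' : u ∈ Ideal.span (Set.range x) := by simpa [hspan] using hu
    induction hu' using Submodule.span_induction with
    | mem u hu' =>
      obtain ⟨i, rfl⟩ := hu'
      exact ⟨MvPolynomial.X i, gradedEval_X I c x hx i⟩
    | zero =>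
      have : reesMonomial 1 0 hu = 0 := Subtype.ext (map_zero (Polynomial.monomial 1))
      rw [this, map_zero]
      exact zero_mem _
    | add u v hu' hv' ihu ihv =>
      have hu1 : u ∈ I ^ 1 := by simpa [hspan] using hu'
      have hv1 : v ∈ I ^ 1 := by simpa [hspan] using hv'
      have : reesMonomial 1 (u + v) hu = reesMonomial 1 u hu1 + reesMonomial 1 v hv1 :=
        Subtype.ext (map_add (Polynomial.monomial 1) u v)
      rw [this, map_add]
      exact add_mem (ihu hu1) (ihv hv1)
    | smul a u hu' ih =>
      have hu1 : u ∈ I ^ 1 := by simpa [hspan] using hu'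
      have : reesMonomial 1 (a • u) hu = algebraMap A (reesAlgebra I) a * reesMonomial 1 u hu1 :=
        Subtype.ext (Polynomial.C_mul_monomial (a := a) (b := u) (n := 1)).symm
      rw [this, map_mul]
      exact mul_mem (h0 a) (ih hu1)
  have h2 : ∀ (i : ℕ) (u : A) (hu : u ∈ I ^ i),
      Ideal.Quotient.mk (I.map (algebraMap A (reesAlgebra I))) (reesMonomial i u hu) ∈
        (gradedEval I c x hx).range := by
    intro i
    induction i with
    | zero => exact fun u _ => h0 u
    | succ i ih =>
      intro u hu
      have hu' : u ∈ I * I ^ i := by rwa [← pow_succ']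
      induction hu' using Submodule.mul_induction_on' with
      | mem_mul_mem v hv w hw =>
        have hv1 : v ∈ I ^ 1 := by simpa using hv
        have : reesMonomial (i + 1) (v * w) hu = reesMonomial 1 v hv1 * reesMonomial i w hw := by
          apply Subtype.ext
          change _ = Polynomial.monomial 1 v * Polynomial.monomial i w
          rw [Polynomial.monomial_mul_monomial, add_comm 1 i]
          rfl
        rw [this, map_mul]
        exact mul_mem (h1 v hv1) (ih w hw)
      | add v hv w hw ihv ihw =>
        have hv1 : v ∈ I ^ (i + 1) := by rwa [pow_succ']
        have hw1 : w ∈ I ^ (i + 1) := by rwa [pow_succ']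
        have : reesMonomial (i + 1) (v + w) hu =
            reesMonomial (i + 1) v hv1 + reesMonomial (i + 1) w hw1 :=
          Subtype.ext (map_add (Polynomial.monomial (i + 1)) v w)
        rw [this, map_add]
        exact add_mem (ihv hv1) (ihw hw1)
  intro y
  obtain ⟨p, rfl⟩ := Ideal.Quotient.mk_surjective y
  change _ ∈ (gradedEval I c x hx).range
  rw [reesAlgebra_eq_sum p, map_sum]
  exact sum_mem fun i _ => h2 i _ _

theorem gradedEval_eq_zero_iff (f : MvPolynomial σ k) :
    gradedEval I c x hx f = 0 ↔
      ∀ i, (reesEval I c x hx f : A[X]).coeff i ∈ I ^ (i + 1) := by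
  rw [gradedEval, RingHom.comp_apply, Ideal.Quotient.eq_zero_iff_mem, map_algebraMap_reesAlgebra]
  rfl

theorem assocGradedMap_comp_gradedEval {B : Type*} [CommRing B] (f : A →+* B) (J : Ideal B)
    (h : I.map f ≤ J) (hx' : ∀ i, f (x i) ∈ J) :
    (assocGradedMap f I J h).comp (gradedEval I c x hx) =
      gradedEval J (f.comp c) (fun i => f (x i)) hx' := by
  apply MvPolynomial.ringHom_ext
  · intro r
    rw [RingHom.comp_apply, gradedEval_C, gradedEval_C, assocGradedMap, Ideal.quotientMap_mk]
    congr 1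
    apply Subtype.ext
    exact Polynomial.map_C f
  · intro i
    rw [RingHom.comp_apply, gradedEval_X, gradedEval_X, assocGradedMap, Ideal.quotientMap_mk]
    congr 1
    apply Subtype.ext
    exact Polynomial.map_monomial f

end Eval

end AssociatedGraded

/-! ### The tangent cone as a bigraded quotient of a polynomial ring. -/

section TangentConeDescription

variable (k : Type*) [Field k] {d : ℕ} (n : Fin d → ℕ+)

/-- The sum of the coefficients of the monomials of degree `e` and weight `s`. -/
noncomputable def bigradedCoeff (e s : ℕ) : MvPolynomial (Fin d) k →ₗ[k] k :=
  (MvPolynomial.basisMonomials (Fin d) k).constr k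
    fun a => if a.degree = e ∧ expWeight n a = s then 1 else 0

theorem bigradedCoeff_monomial (e s : ℕ) (a : Fin d →₀ ℕ) (r : k) :
    bigradedCoeff k n e s (MvPolynomial.monomial a r) =
      if a.degree = e ∧ expWeight n a = s then r else 0 := by
  have h1 : MvPolynomial.monomial a r = r • MvPolynomial.basisMonomials (Fin d) k a := by
    rw [MvPolynomial.coe_basisMonomials, MvPolynomial.smul_monomial, smul_eq_mul, mul_one]
  rw [h1, map_smul, bigradedCoeff, Module.Basis.constr_basis, smul_eq_mul, mul_ite, mul_one,
    mul_zero]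

/-- The surjection `k[X_1, …, X_d] → gr_𝔫(k[[x_1, …, x_d]])`. -/
noncomputable def powerSeriesGradedEval : MvPolynomial (Fin d) k →+*
    AssocGraded (IsLocalRing.maximalIdeal (MvPowerSeries (Fin d) k)) :=
  gradedEval _ (algebraMap k (MvPowerSeries (Fin d) k)) MvPowerSeries.X
    fun i => (mem_maximalIdeal_iff_constantCoeff k _).2 (MvPowerSeries.constantCoeff_X i)

theorem powerSeriesGradedEval_surjective :
    Function.Surjective (powerSeriesGradedEval k (d := d)) := by
  refine gradedEval_surjective _ _ _ _ (span_X_eq_maximalIdeal k) fun u =>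
    ⟨MvPowerSeries.constantCoeff u, ?_⟩
  rw [mem_maximalIdeal_iff_constantCoeff, map_sub, sub_eq_zero]
  exact (MvPowerSeries.constantCoeff_C _).symm

theorem semigroupGen_mem_maximalIdeal (i : Fin d) :
    semigroupGen k n i ∈ IsLocalRing.maximalIdeal (NumSemigroupRing k n) := by
  rw [← orderIdeal_one]
  exact semigroupGen_mem_orderIdeal k n i

/-- The surjection `k[X_1, …, X_d] → gr_𝔪(R)` onto the tangent cone. -/
noncomputable def tangentConeEval : MvPolynomial (Fin d) k →+* TangentCone k n :=
  gradedEval _ (algebraMap k (NumSemigroupRing k n)) (semigroupGen k n)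
    (semigroupGen_mem_maximalIdeal k n)

theorem tangentConeEval_surjective : Function.Surjective (tangentConeEval k n) := by
  refine gradedEval_surjective _ _ _ _ (span_semigroupGen k n) fun u =>
    ⟨PowerSeries.coeff 0 (u : PowerSeries k), ?_⟩
  rw [mem_maximalIdeal_numSemigroupRing_iff]
  change PowerSeries.coeff 0 ((u : PowerSeries k) - algebraMap k (PowerSeries k) _) = 0
  rw [map_sub, sub_eq_zero]
  exact (PowerSeries.coeff_zero_C _).symm

theorem assocGradedMap_comp_powerSeriesGradedEval :
    (assocGradedMap (presentation k n) _ _ (presentation_map_maximalIdeal_le k n)).comp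
      (powerSeriesGradedEval k) = tangentConeEval k n := by
  have h : ∀ i, presentation k n (MvPowerSeries.X i) ∈
      IsLocalRing.maximalIdeal (NumSemigroupRing k n) := fun i => by
    rw [presentation_X]
    exact semigroupGen_mem_maximalIdeal k n i
  rw [powerSeriesGradedEval, assocGradedMap_comp_gradedEval _ _ _ _ _ _ _ h]
  have h1 : (presentation k n).comp (algebraMap k (MvPowerSeries (Fin d) k)) =
      algebraMap k (NumSemigroupRing k n) :=
    (paramHom k n).rangeRestrict.comp_algebraMap
  have h2 : (fun i => presentation k n (MvPowerSeries.X i)) = semigroupGen k n :=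
    funext (presentation_X k n)
  simp only [h1, h2]
  rfl

/-- Generators of the kernel in the polynomial ring thus push forward to generators of I*. Only
surjectivity onto `gr_𝔫(S)` is needed, not that this map is an isomorphism. -/
theorem initialFormIdeal_eq_map :
    initialFormIdeal k n =
      (RingHom.ker (tangentConeEval k n)).map (powerSeriesGradedEval k) := by
  rw [← assocGradedMap_comp_powerSeriesGradedEval, ← RingHom.comap_ker,
    Ideal.map_comap_of_surjective _ (powerSeriesGradedEval_surjective k)]
  rfl

theorem coeff_coeff_reesEval (f : MvPolynomial (Fin d) k) (e s : ℕ) :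
    PowerSeries.coeff s ((((reesEval _ (algebraMap k (NumSemigroupRing k n)) (semigroupGen k n)
      (semigroupGen_mem_maximalIdeal k n) f : Polynomial (NumSemigroupRing k n)).coeff e :
        NumSemigroupRing k n)) : PowerSeries k) = bigradedCoeff k n e s f := by
  induction f using MvPolynomial.induction_on' with
  | monomial a r =>
    rw [reesEval_monomial, Polynomial.coeff_monomial, bigradedCoeff_monomial]
    by_cases h1 : a.degree = e
    · rw [if_pos h1]
      have h2 : ((algebraMap k (NumSemigroupRing k n) r *
          a.prod fun i e => semigroupGen k n i ^ e : NumSemigroupRing k n) : PowerSeries k) =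
          PowerSeries.C r * PowerSeries.X ^ expWeight n a := by
        change PowerSeries.C r * (NumSemigroupRing k n).val _ = _
        rw [Finsupp.prod_fintype _ _ (by simp), map_prod, expWeight_eq_sum,
          ← Finset.prod_pow_eq_pow_sum]
        congr 1
        refine Finset.prod_congr rfl fun i _ => ?_
        rw [map_pow, mul_comm, pow_mul]
        rfl
      rw [h2, PowerSeries.coeff_C_mul, PowerSeries.coeff_X_pow]
      by_cases h3 : expWeight n a = s
      · rw [if_pos h3.symm, if_pos ⟨h1, h3⟩, mul_one]
      · rw [if_neg (Ne.symm h3), if_neg fun h => h3 h.2, mul_zero]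
    · rw [if_neg h1, if_neg fun h => h1 h.1]
      exact map_zero _
  | add p q hp hq =>
    rw [map_add (bigradedCoeff k n e s), ← hp, ← hq, RingHom.map_add]
    change PowerSeries.coeff s (((_ + _ : Polynomial (NumSemigroupRing k n)).coeff e :
      NumSemigroupRing k n) : PowerSeries k) = _
    rw [Polynomial.coeff_add]
    exact map_add (PowerSeries.coeff s) _ _

/-- All monomials of bidegree (e, s) map to the same class t^s T^e, so only the sum of their
coefficients counts, and that class dies exactly when t^s lies in 𝔪^(e+1). -/
theorem tangentConeEval_eq_zero_iff (f : MvPolynomial (Fin d) k) :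
    tangentConeEval k n f = 0 ↔
      ∀ e s, bigradedCoeff k n e s f ≠ 0 → LongFactorization n s (e + 1) := by
  rw [tangentConeEval, gradedEval_eq_zero_iff]
  refine forall_congr' fun e => ?_
  rw [maximalIdeal_pow_eq_orderIdeal, mem_orderIdeal]
  refine forall_congr' fun s => ?_
  rw [coeff_coeff_reesEval]

theorem tangentConeEval_monomial_eq_zero_iff (a : Fin d →₀ ℕ) :
    tangentConeEval k n (MvPolynomial.monomial a 1) = 0 ↔
      LongFactorization n (expWeight n a) (a.degree + 1) := by
  rw [tangentConeEval_eq_zero_iff]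
  constructor
  · intro h
    refine h _ _ ?_
    rw [bigradedCoeff_monomial, if_pos ⟨rfl, rfl⟩]
    exact one_ne_zero
  · intro h e s hs
    rw [bigradedCoeff_monomial] at hs
    by_cases h1 : a.degree = e ∧ expWeight n a = s
    · exact h1.1 ▸ h1.2 ▸ h
    · exact absurd (if_neg h1) hs

theorem tangentConeEval_monomial_eq {a b : Fin d →₀ ℕ} (hdeg : a.degree = b.degree)
    (hw : expWeight n a = expWeight n b) :
    tangentConeEval k n (MvPolynomial.monomial a 1) =
      tangentConeEval k n (MvPolynomial.monomial b 1) := by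
  rw [← sub_eq_zero, ← map_sub, tangentConeEval_eq_zero_iff]
  intro e s hs
  rw [map_sub, bigradedCoeff_monomial, bigradedCoeff_monomial, hdeg, hw, sub_self] at hs
  exact absurd rfl hs

end TangentConeDescription

/-! ### Normal forms modulo an ideal of the polynomial ring. -/

section NormalForm

variable (k : Type*) [Field k] {d : ℕ} (n : Fin d → ℕ+)

/-- A terminating rewriting argument: outside S a monomial is either dropped or replaced by one of
smaller μ. -/
theorem exists_normal_form {σ : Type*} (K : Ideal (MvPolynomial σ k)) (S : Set (σ →₀ ℕ))
    (μ : (σ →₀ ℕ) → ℕ)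
    (hred : ∀ a ∉ S, MvPolynomial.monomial a 1 ∈ K ∨
      ∃ b, MvPolynomial.monomial a 1 - MvPolynomial.monomial b 1 ∈ K ∧ μ b < μ a)
    (f : MvPolynomial σ k) :
    ∃ g : MvPolynomial σ k, (∀ a ∉ S, g.coeff a = 0) ∧ f - g ∈ K := by
  classical
  have hmon : ∀ m a, μ a = m → ∃ g : MvPolynomial σ k,
      (∀ a ∉ S, g.coeff a = 0) ∧ MvPolynomial.monomial a 1 - g ∈ K := by
    intro m
    induction m using Nat.strong_induction_on with
    | _ m ih =>
      intro a ha
      by_cases haS : a ∈ S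
      · refine ⟨MvPolynomial.monomial a 1, fun b hb => ?_, by simp⟩
        rw [MvPolynomial.coeff_monomial, if_neg]
        rintro rfl
        exact hb haS
      · obtain h | ⟨b, hb, hlt⟩ := hred a haS
        · exact ⟨0, by simp, by simpa using h⟩
        · obtain ⟨g, hg, hg'⟩ := ih (μ b) (ha ▸ hlt) b rfl
          exact ⟨g, hg, by simpa using add_mem hb hg'⟩
  induction f using MvPolynomial.induction_on' with
  | monomial a r =>
    obtain ⟨g, hg, hg'⟩ := hmon _ a rfl
    refine ⟨MvPolynomial.C r * g, fun b hb => ?_, ?_⟩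
    · rw [MvPolynomial.coeff_C_mul, hg b hb, mul_zero]
    · have := K.mul_mem_left (MvPolynomial.C r) hg'
      rwa [mul_sub, MvPolynomial.C_mul_monomial, mul_one] at this
  | add p q hp hq =>
    obtain ⟨g, hg, hg'⟩ := hp
    obtain ⟨h, hh, hh'⟩ := hq
    refine ⟨g + h, fun b hb => ?_, ?_⟩
    · rw [MvPolynomial.coeff_add, hg b hb, hh b hb, add_zero]
    · rw [add_sub_add_comm]
      exact add_mem hg' hh'

/-- The criterion by which candidate generators are recognized. Reduction modulo K leaves a
combination of monomials from S; `hinj` puts these in different bidegrees and `hmax` makes each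
nonzero in the cone, so a normal form in the kernel is 0. -/
theorem ker_tangentConeEval_eq_of_normal_form (K : Ideal (MvPolynomial (Fin d) k))
    (hK : K ≤ RingHom.ker (tangentConeEval k n)) (S : Set (Fin d →₀ ℕ)) (μ : (Fin d →₀ ℕ) → ℕ)
    (hred : ∀ a ∉ S, MvPolynomial.monomial a 1 ∈ K ∨
      ∃ b, MvPolynomial.monomial a 1 - MvPolynomial.monomial b 1 ∈ K ∧ μ b < μ a)
    (hmax : ∀ a ∈ S, ¬ LongFactorization n (expWeight n a) (a.degree + 1))
    (hinj : ∀ a ∈ S, ∀ b ∈ S, a.degree = b.degree → expWeight n a = expWeight n b → a = b) :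
    K = RingHom.ker (tangentConeEval k n) := by
  refine le_antisymm hK fun f hf => ?_
  obtain ⟨g, hg, hg'⟩ := exists_normal_form k K S μ hred f
  suffices h : g = 0 by simpa [h] using hg'
  have hgker : tangentConeEval k n g = 0 := by
    have := hK hg'
    rw [RingHom.mem_ker] at hf this
    rw [map_sub, hf, zero_sub, neg_eq_zero] at this
    exact this
  rw [tangentConeEval_eq_zero_iff] at hgker
  ext a
  rw [MvPolynomial.coeff_zero]
  by_contra ha
  have haS : a ∈ S := by
    by_contra h
    exact ha (hg a h)
  refine hmax a haS (hgker a.degree (expWeight n a) ?_)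
  have h1 : bigradedCoeff k n a.degree (expWeight n a) g = g.coeff a := by
    conv_lhs => rw [← MvPolynomial.support_sum_monomial_coeff g]
    rw [map_sum, Finset.sum_eq_single a]
    · rw [bigradedCoeff_monomial, if_pos ⟨rfl, rfl⟩]
    · intro b hb hba
      rw [bigradedCoeff_monomial, if_neg]
      rintro ⟨h1, h2⟩
      refine hba (hinj b ?_ a haS h1 h2)
      by_contra h
      exact MvPolynomial.mem_support_iff.1 hb (hg b h)
    · intro h
      rw [MvPolynomial.notMem_support_iff.1 h, MvPolynomial.monomial_zero, map_zero]
  rwa [h1]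

end NormalForm

/-! ### Exponent vectors in three variables and dominating sets in ℕ × ℕ. -/

section ThreeGenerators

/-- The exponent vector `(p, q, r)`. -/
noncomputable def expVec (p q r : ℕ) : Fin 3 →₀ ℕ :=
  Finsupp.equivFunOnFinite.symm ![p, q, r]

theorem expVec_eta (a : Fin 3 →₀ ℕ) : expVec (a 0) (a 1) (a 2) = a := by
  ext i
  fin_cases i <;> rfl

theorem expVec_add (p q r p' q' r' : ℕ) :
    expVec p q r + expVec p' q' r' = expVec (p + p') (q + q') (r + r') := by
  ext i
  fin_cases i <;> rfl

theorem degree_expVec (p q r : ℕ) : (expVec p q r).degree = p + q + r := by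
  rw [Finsupp.degree_eq_sum, Fin.sum_univ_three]
  rfl

theorem expWeight_expVec (n : Fin 3 → ℕ+) (p q r : ℕ) :
    expWeight n (expVec p q r) = p * n 0 + q * n 1 + r * n 2 := by
  rw [expWeight_eq_sum, Fin.sum_univ_three]
  rfl

theorem forall_expVec {P : (Fin 3 →₀ ℕ) → Prop} : (∀ a, P a) ↔ ∀ p q r, P (expVec p q r) :=
  ⟨fun h _ _ _ => h _, fun h a => expVec_eta a ▸ h _ _ _⟩

/-- `s = p x + q y + r z` for some natural numbers with `e ≤ p + q + r`. -/
def LongSum (x y z s e : ℕ) : Prop :=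
  ∃ p q r, p * x + q * y + r * z = s ∧ e ≤ p + q + r

theorem longFactorization_iff (n : Fin 3 → ℕ+) (s e : ℕ) :
    LongFactorization n s e ↔ LongSum (n 0) (n 1) (n 2) s e := by
  constructor
  · rintro ⟨a, rfl, h⟩
    rw [← expVec_eta a, degree_expVec] at h
    exact ⟨a 0, a 1, a 2, by rw [← expWeight_expVec, expVec_eta], h⟩
  · rintro ⟨p, q, r, rfl, h⟩
    exact ⟨expVec p q r, expWeight_expVec n p q r, by rwa [degree_expVec]⟩

/-- The monomial `X^p Y^q Z^r`. -/
noncomputable abbrev triMonomial (k : Type*) [Field k] (p q r : ℕ) : MvPolynomial (Fin 3) k :=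
  MvPolynomial.monomial (expVec p q r) 1

theorem triMonomial_mul (k : Type*) [Field k] (p q r p' q' r' : ℕ) :
    triMonomial k p q r * triMonomial k p' q' r' = triMonomial k (p + p') (q + q') (r + r') := by
  rw [triMonomial, triMonomial, MvPolynomial.monomial_mul, expVec_add, mul_one]

theorem triMonomial_mem_ker_iff (k : Type*) [Field k] (n : Fin 3 → ℕ+) (p q r : ℕ) :
    triMonomial k p q r ∈ RingHom.ker (tangentConeEval k n) ↔
      LongSum (n 0) (n 1) (n 2) (p * n 0 + q * n 1 + r * n 2) (p + q + r + 1) := by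
  rw [RingHom.mem_ker, tangentConeEval_monomial_eq_zero_iff, longFactorization_iff,
    expWeight_expVec, degree_expVec]

theorem triMonomial_sub_mem_ker (k : Type*) [Field k] (n : Fin 3 → ℕ+) {p q r p' q' r' : ℕ}
    (hdeg : p + q + r = p' + q' + r')
    (hw : p * n 0 + q * n 1 + r * n 2 = p' * n 0 + q' * n 1 + r' * (n 2 : ℕ)) :
    triMonomial k p q r - triMonomial k p' q' r' ∈ RingHom.ker (tangentConeEval k n) := by
  rw [RingHom.mem_ker, map_sub, sub_eq_zero]
  apply tangentConeEval_monomial_eq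
  · rwa [degree_expVec, degree_expVec]
  · rwa [expWeight_expVec, expWeight_expVec]

theorem LongSum.mono {x y z s e e' : ℕ} (h : LongSum x y z s e) (he : e' ≤ e) :
    LongSum x y z s e' :=
  let ⟨p, q, r, h1, h2⟩ := h
  ⟨p, q, r, h1, he.trans h2⟩

/-- A subset of `ℕ × ℕ` meeting both axes and having at most one minimal element off the axes is
dominated by at most three of its elements. -/
theorem exists_three_minimal_elements (P : ℕ → ℕ → Prop)
    {B C : ℕ} (hB : P B 0) (hC : P 0 C)
    (huniq : ∀ q r q' r', P (q + 1) (r + 1) → ¬ P q (r + 1) → ¬ P (q + 1) r →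
      P (q' + 1) (r' + 1) → ¬ P q' (r' + 1) → ¬ P (q' + 1) r' → q = q' ∧ r = r') :
    ∃ T : Finset (ℕ × ℕ), T.card ≤ 3 ∧ (∀ t ∈ T, P t.1 t.2) ∧
      ∀ q r, P q r → ∃ t ∈ T, t.1 ≤ q ∧ t.2 ≤ r := by
  classical
  have hB' : ∃ B, P B 0 := ⟨B, hB⟩
  have hC' : ∃ C, P 0 C := ⟨C, hC⟩
  have key : ∃ t : ℕ × ℕ, P t.1 t.2 ∧ ∀ q r, P (q + 1) (r + 1) → ¬ P q (r + 1) →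
      ¬ P (q + 1) r → t = (q + 1, r + 1) := by
    by_cases h : ∃ q r, P (q + 1) (r + 1) ∧ ¬ P q (r + 1) ∧ ¬ P (q + 1) r
    · obtain ⟨q, r, h1, h2, h3⟩ := h
      refine ⟨(q + 1, r + 1), h1, fun q' r' h1' h2' h3' => ?_⟩
      obtain ⟨rfl, rfl⟩ := huniq q r q' r' h1 h2 h3 h1' h2' h3'
      rfl
    · exact ⟨(B, 0), hB, fun q r h1 h2 h3 => absurd ⟨q, r, h1, h2, h3⟩ h⟩
  obtain ⟨t, ht, htmin⟩ := key
  refine ⟨{(Nat.find hB', 0), (0, Nat.find hC'), t}, Finset.card_le_three, ?_, ?_⟩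
  · intro u hu
    simp only [Finset.mem_insert, Finset.mem_singleton] at hu
    obtain rfl | rfl | rfl := hu
    · exact Nat.find_spec hB'
    · exact Nat.find_spec hC'
    · exact ht
  -- Descend by unit steps inside the set until an axis or a minimal element off the axes is
  -- reached.
  · have hdesc : ∀ m q r, q + r = m → P q r → Nat.find hB' ≤ q ∨ Nat.find hC' ≤ r ∨
        (t.1 ≤ q ∧ t.2 ≤ r) := by
      intro m
      induction m with
      | zero =>
        intro q r hqr h
        obtain ⟨rfl, rfl⟩ : q = 0 ∧ r = 0 := by omega
        exact Or.inl (Nat.find_min' hB' h)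
      | succ m ih =>
        intro q r hqr h
        obtain _ | q := q
        · exact Or.inr (Or.inl (Nat.find_min' hC' h))
        obtain _ | r := r
        · exact Or.inl (Nat.find_min' hB' h)
        by_cases h2 : P q (r + 1)
        · have := ih q (r + 1) (by omega) h2
          omega
        by_cases h3 : P (q + 1) r
        · have := ih (q + 1) r (by omega) h3
          omega
        rw [htmin q r h h2 h3]
        exact Or.inr (Or.inr ⟨le_rfl, le_rfl⟩)
    intro q r h
    obtain h1 | h1 | h1 := hdesc _ q r rfl h
    · exact ⟨(Nat.find hB', 0), by simp, h1, Nat.zero_le _⟩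
    · exact ⟨(0, Nat.find hC'), by simp, Nat.zero_le _, h1⟩
    · exact ⟨t, by simp, h1⟩

end ThreeGenerators

/-! ### The case where X is a nonzerodivisor: three generators. -/

section RegularCase

/-- The monomial `Y^q Z^r` is not part of the standard basis of the tangent cone modulo `X`. -/
def NonStandard (x y z q r : ℕ) : Prop :=
  LongSum x y z (q * y + r * z) (q + r + 1) ∨
    ∃ p q' r', 0 < p ∧ p * x + q' * y + r' * z = q * y + r * z

variable {x y z : ℕ}

theorem NonStandard.mono {q r q' r' : ℕ} (h : NonStandard x y z q r) (hq : q ≤ q') (hr : r ≤ r') :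
    NonStandard x y z q' r' := by
  obtain ⟨u, rfl⟩ := exists_add_of_le hq
  obtain ⟨v, rfl⟩ := exists_add_of_le hr
  obtain ⟨a, b, c, h1, h2⟩ | ⟨a, b, c, h0, h1⟩ := h
  · exact Or.inl ⟨a, b + u, c + v, by linarith, by omega⟩
  · exact Or.inr ⟨a, b + u, c + v, h0, by linarith⟩

/-- If the other side of the witnessing relation involved y or z, cancelling one copy would make a
smaller monomial nonstandard. -/
theorem exists_eq_mul_of_minimal {q r : ℕ}
    (h : NonStandard x y z (q + 1) (r + 1))
    (hq : ¬ NonStandard x y z q (r + 1)) (hr : ¬ NonStandard x y z (q + 1) r) :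
    ∃ p, p * x = (q + 1) * y + (r + 1) * z := by
  obtain ⟨a, b, c, h1, h2⟩ | ⟨a, b, c, h0, h1⟩ := h
  · obtain _ | b := b
    · obtain _ | c := c
      · exact ⟨a, by linarith⟩
      · exact absurd (Or.inl ⟨a, 0, c, by linarith, by omega⟩) hr
    · exact absurd (Or.inl ⟨a, b, c, by linarith, by omega⟩) hq
  · obtain _ | b := b
    · obtain _ | c := c
      · exact ⟨a, by linarith⟩
      · exact absurd (Or.inr ⟨a, 0, c, h0, by linarith⟩) hr
    · exact absurd (Or.inr ⟨a, b, c, h0, by linarith⟩) hq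

/-- Two minimal elements off the axes both equal multiples of x; their difference makes a pure power
of Y or Z nonstandard, below one of them. -/
theorem minimal_nonStandard_not_lt {q r q' r' : ℕ} (hyz : y < z)
    (h : NonStandard x y z (q + 1) (r + 1))
    (hq : ¬ NonStandard x y z q (r + 1)) (hr : ¬ NonStandard x y z (q + 1) r)
    (h' : NonStandard x y z (q' + 1) (r' + 1))
    (hq' : ¬ NonStandard x y z q' (r' + 1)) (hr' : ¬ NonStandard x y z (q' + 1) r') :
    ¬ q < q' := by
  intro hlt
  obtain ⟨p, hp⟩ := exists_eq_mul_of_minimal h hq hr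
  obtain ⟨p', hp'⟩ := exists_eq_mul_of_minimal h' hq' hr'
  have hrr : r' < r := by
    by_contra hle
    exact hq' (h.mono (by omega) (by omega))
  obtain ⟨u, rfl⟩ := exists_add_of_le hlt.le
  obtain ⟨v, rfl⟩ := exists_add_of_le hrr.le
  -- With u = q' - q and v = r - r', the difference reads uy = (p' - p)x + vz or vz = (p - p')x +
  -- uy; if p = p' then uy = vz and y < z make Y^u longer than Z^v.
  rcases lt_trichotomy p p' with hpp | rfl | hpp
  · obtain ⟨w, rfl⟩ := exists_add_of_le hpp.le
    have : NonStandard x y z u 0 := Or.inr ⟨w, 0, v, by omega, by linarith⟩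
    exact hq' (this.mono (by omega) (by omega))
  · have huv : u * y = v * z := by linarith
    have : v < u := by
      by_contra hle
      have h1 : u * y ≤ v * y := Nat.mul_le_mul_right _ (by omega)
      have h2 : v * y < v * z := Nat.mul_lt_mul_of_pos_left hyz (by omega)
      omega
    have : NonStandard x y z 0 v := Or.inl ⟨0, u, 0, by linarith, by omega⟩
    exact hr (this.mono (by omega) (by omega))
  · obtain ⟨w, rfl⟩ := exists_add_of_le hpp.le
    have : NonStandard x y z 0 v := Or.inr ⟨w, u, 0, by omega, by linarith⟩
    exact hr (this.mono (by omega) (by omega))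

theorem exists_generators_nonStandard (hx : 0 < x) (hxy : x < y) (hyz : y < z) :
    ∃ T : Finset (ℕ × ℕ), T.card ≤ 3 ∧ (∀ t ∈ T, NonStandard x y z t.1 t.2) ∧
      ∀ q r, NonStandard x y z q r → ∃ t ∈ T, t.1 ≤ q ∧ t.2 ≤ r := by
  -- Both axes are met because Y^x trades for X^y and Z^x for X^z.
  refine exists_three_minimal_elements (NonStandard x y z) (B := x) (C := x)
    (Or.inr ⟨y, 0, 0, by omega, by ring⟩) (Or.inr ⟨z, 0, 0, by omega, by ring⟩) ?_
  intro q r q' r' h h1 h2 h' h1' h2'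
  have e1 := minimal_nonStandard_not_lt hyz h h1 h2 h' h1' h2'
  have e2 := minimal_nonStandard_not_lt hyz h' h1' h2' h h1 h2
  obtain rfl : q = q' := by omega
  refine ⟨rfl, ?_⟩
  by_contra hne
  rcases lt_or_gt_of_ne hne with h3 | h3
  · exact h2' (h.mono le_rfl (by omega))
  · exact h2 (h'.mono le_rfl (by omega))

/-- Adding `x` to an element of the semigroup raises its order by exactly one, i.e. the class of
`t^x` is a nonzerodivisor on the tangent cone. -/
def OrderRegular (x y z : ℕ) : Prop :=
  ∀ p q r, LongSum x y z (p * x + q * y + r * z + x) (p + q + r + 2) →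
    LongSum x y z (p * x + q * y + r * z) (p + q + r + 1)

/-- The definition lengthens a given factorization by one. Starting from any factorization and
repeating reaches every length e. -/
theorem OrderRegular.longSum (h : OrderRegular x y z) {p q r e : ℕ}
    (hs : LongSum x y z (p * x + q * y + r * z + x) (e + 1)) :
    LongSum x y z (p * x + q * y + r * z) e := by
  have key : ∀ i ≤ e, LongSum x y z (p * x + q * y + r * z) i := by
    intro i
    induction i with
    | zero => exact fun _ => ⟨p, q, r, rfl, Nat.zero_le _⟩
    | succ i ih =>
      intro hi
      obtain ⟨p', q', r', h1, h2⟩ := ih (by omega)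
      by_cases h3 : i + 1 ≤ p' + q' + r'
      · exact ⟨p', q', r', h1, h3⟩
      · rw [← h1] at hs ⊢
        exact (h p' q' r' (hs.mono (by omega))).mono (by omega)
  exact key e le_rfl

theorem OrderRegular.longSum_of_add_mul (h : OrderRegular x y z) {q r p e : ℕ}
    (hs : LongSum x y z (p * x + q * y + r * z) (p + e)) :
    LongSum x y z (q * y + r * z) e := by
  induction p with
  | zero => simpa using hs
  | succ p ih =>
    refine ih (h.longSum ?_)
    convert hs using 1 <;> ring

/-- A relation of the tangent cone witnessing that `Y^q Z^r` is not standard. -/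
theorem OrderRegular.exists_relation (k : Type*) [Field k] (n : Fin 3 → ℕ+)
    (h : OrderRegular (n 0) (n 1) (n 2)) {q r : ℕ} (hqr : NonStandard (n 0) (n 1) (n 2) q r) :
    ∃ F ∈ RingHom.ker (tangentConeEval k n), triMonomial k 0 q r = F ∨
      ∃ p q' r', 0 < p ∧ p + q' + r' = q + r ∧
        triMonomial k 0 q r - triMonomial k p q' r' = F := by
  by_cases hl : LongSum (n 0) (n 1) (n 2) (q * n 1 + r * n 2) (q + r + 1)
  · refine ⟨_, ?_, Or.inl rfl⟩
    rw [triMonomial_mem_ker_iff]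
    simpa using hl
  · obtain h' | ⟨p, q', r', hp, hw⟩ := hqr
    · exact absurd h' hl
    obtain ⟨p, rfl⟩ := Nat.exists_eq_succ_of_ne_zero hp.ne'
    have hlen : 0 < q + r := by
      by_contra h0
      obtain ⟨rfl, rfl⟩ : q = 0 ∧ r = 0 := by omega
      have := (n 0).pos
      rw [Nat.succ_mul] at hw
      omega
    obtain ⟨e, he⟩ := Nat.exists_eq_succ_of_ne_zero hlen.ne'
    -- The relation produced by `NonStandard` may be too short. Regularity gives the weight minus x
    -- a factorization of length q + r - 1, and adding x back yields length exactly q + r with X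
    -- present.
    have h1 : LongSum (n 0) (n 1) (n 2) (p * n 0 + q' * n 1 + r' * n 2) e := by
      refine h.longSum ⟨0, q, r, ?_, by omega⟩
      rw [Nat.succ_mul] at hw
      omega
    obtain ⟨p', q', r', h2, h3⟩ := h1
    have hw' : (p' + 1) * n 0 + q' * n 1 + r' * n 2 = q * n 1 + r * (n 2 : ℕ) := by
      rw [Nat.succ_mul] at hw
      rw [Nat.succ_mul]
      omega
    have hdeg : p' + 1 + q' + r' = q + r := by
      by_contra hne
      exact hl ⟨p' + 1, q', r', hw', by omega⟩
    refine ⟨_, ?_, Or.inr ⟨p' + 1, q', r', by omega, hdeg, rfl⟩⟩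
    exact triMonomial_sub_mem_ker k n (by omega) (by omega)

/-- One relation per dominating monomial suffices: each use kills the monomial or trades part of its
Y, Z degree for X, so the degree in Y and Z is the termination measure. Distinct standard monomials
with the same X-exponent and degree have different weights because y < z. -/
theorem OrderRegular.exists_generators (k : Type*) [Field k] (n : Fin 3 → ℕ+)
    (h01 : n 0 < n 1) (h12 : n 1 < n 2) (h : OrderRegular (n 0) (n 1) (n 2)) :
    ∃ s : Finset (MvPolynomial (Fin 3) k), s.card ≤ 3 ∧
      Ideal.span (s : Set (MvPolynomial (Fin 3) k)) = RingHom.ker (tangentConeEval k n) := by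
  classical
  obtain ⟨T, hT, hT1, hT2⟩ := exists_generators_nonStandard (n 0).pos
    (PNat.coe_lt_coe _ _ |>.2 h01) (PNat.coe_lt_coe _ _ |>.2 h12)
  choose! F hF hF' using fun (t : ℕ × ℕ) (ht : NonStandard (n 0) (n 1) (n 2) t.1 t.2) =>
    h.exists_relation k n ht
  refine ⟨T.image F, Finset.card_image_le.trans hT, ?_⟩
  refine ker_tangentConeEval_eq_of_normal_form k n _ ?_
    {a | ¬ NonStandard (n 0) (n 1) (n 2) (a 1) (a 2)} (fun a => a 1 + a 2) ?_ ?_ ?_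
  · rw [Ideal.span_le, Finset.coe_image]
    rintro _ ⟨t, ht, rfl⟩
    exact hF t (hT1 t ht)
  · rw [forall_expVec]
    intro p q r hpqr
    have hpqr : NonStandard (n 0) (n 1) (n 2) q r := not_not.1 hpqr
    obtain ⟨t, ht, hq, hr⟩ := hT2 q r hpqr
    obtain ⟨u, rfl⟩ := exists_add_of_le hq
    obtain ⟨v, rfl⟩ := exists_add_of_le hr
    have hmem : F t ∈ Ideal.span ((T.image F : Finset _) : Set (MvPolynomial (Fin 3) k)) :=
      Ideal.subset_span (Finset.mem_coe.2 (Finset.mem_image_of_mem F ht))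
    have hmem' := Ideal.mul_mem_left _ (triMonomial k p u v) hmem
    have hmon : triMonomial k p u v * triMonomial k 0 t.1 t.2 =
        MvPolynomial.monomial (expVec p (t.1 + u) (t.2 + v)) 1 := by
      rw [triMonomial_mul, add_zero, add_comm u, add_comm v]
    obtain h1 | ⟨p', q', r', hp', hdeg, h1⟩ := hF' t (hT1 t ht)
    · left
      rw [← h1] at hmem'
      rwa [← hmon]
    · right
      rw [← h1, mul_sub, hmon, triMonomial_mul] at hmem'
      refine ⟨_, hmem', ?_⟩
      change u + q' + (v + r') < t.1 + u + (t.2 + v)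
      omega
  · rw [forall_expVec]
    intro p q r hpqr hl
    refine hpqr (Or.inl ?_)
    rw [longFactorization_iff, expWeight_expVec, degree_expVec] at hl
    refine h.longSum_of_add_mul (p := p) (hl.mono ?_)
    change p + (q + r + 1) ≤ _
    omega
  · rw [forall_expVec]
    intro p q r hpqr
    rw [forall_expVec]
    intro p' q' r' hpqr' hdeg hw
    have hpqr : ¬ NonStandard (n 0) (n 1) (n 2) q r := hpqr
    have hpqr' : ¬ NonStandard (n 0) (n 1) (n 2) q' r' := hpqr'
    rw [expWeight_expVec, expWeight_expVec] at hw
    rw [degree_expVec, degree_expVec] at hdeg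
    rcases lt_trichotomy p p' with hpp | rfl | hpp
    · obtain ⟨w, rfl⟩ := exists_add_of_le hpp.le
      exact absurd (Or.inr ⟨w, q', r', by omega, by linarith⟩) hpqr
    · have h12' : (n 1 : ℕ) < n 2 := (PNat.coe_lt_coe _ _).2 h12
      have hq : q = q' := by
        rcases lt_trichotomy q q' with hqq | hqq | hqq
        · obtain ⟨w, rfl⟩ := exists_add_of_le hqq.le
          obtain rfl : r = r' + w := by omega
          have : w * (n 1 : ℕ) < w * n 2 := Nat.mul_lt_mul_of_pos_left h12' (by omega)
          nlinarith
        · exact hqq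
        · obtain ⟨w, rfl⟩ := exists_add_of_le hqq.le
          obtain rfl : r' = r + w := by omega
          have : w * (n 1 : ℕ) < w * n 2 := Nat.mul_lt_mul_of_pos_left h12' (by omega)
          nlinarith
      obtain rfl := hq
      obtain rfl : r = r' := by omega
      rfl
    · obtain ⟨w, rfl⟩ := exists_add_of_le hpp.le
      exact absurd (Or.inr ⟨w, q, r, by omega, by linarith⟩) hpqr'

end RegularCase

/-! ### The Buchsbaum case where X is a zero divisor: four generators. -/

section ExceptionalCase

variable {x y z : ℕ}

/-- The Buchsbaum property of the tangent cone, in terms of factorization lengths: a homogeneous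
element killed by a power of `x` is killed by `x`, `y` and `z`. -/
def OrderBuchsbaum (x y z : ℕ) : Prop :=
  ∀ p q r N, ¬ LongSum x y z (p * x + q * y + r * z) (p + q + r + 1) →
    LongSum x y z (p * x + q * y + r * z + N * x) (p + q + r + N + 1) →
    LongSum x y z (p * x + q * y + r * z + x) (p + q + r + 2) ∧
    LongSum x y z (p * x + q * y + r * z + y) (p + q + r + 2) ∧
    LongSum x y z (p * x + q * y + r * z + z) (p + q + r + 2)

/-- The relations `YZ = X^a`, `X Z^(m+1) = Y^b` together with the minimality of the exponent of
`Z^(m+2) = X^(a-1) Y^(b-1)`. -/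
structure ExceptionalRelations (x y z a b m : ℕ) : Prop where
  x_pos : 0 < x
  x_lt_y : x < y
  y_lt_z : y < z
  yz : y + z = a * x
  xz : x + (m + 1) * z = b * y
  le_b : m + 3 ≤ b
  b_le : b ≤ a + m
  z_min : ∀ j u v, j ≤ m + 1 → j * z = u * x + v * y → j = 0

theorem LongSum.add_left {s e : ℕ} (h : LongSum x y z s e) : LongSum x y z (s + x) (e + 1) := by
  obtain ⟨p, q, r, h1, h2⟩ := h
  exact ⟨p + 1, q, r, by linarith, by omega⟩

theorem LongSum.add_middle {s e : ℕ} (h : LongSum x y z s e) : LongSum x y z (s + y) (e + 1) := by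
  obtain ⟨p, q, r, h1, h2⟩ := h
  exact ⟨p, q + 1, r, by linarith, by omega⟩

theorem LongSum.add_right {s e : ℕ} (h : LongSum x y z s e) : LongSum x y z (s + z) (e + 1) := by
  obtain ⟨p, q, r, h1, h2⟩ := h
  exact ⟨p, q, r + 1, by linarith, by omega⟩

/-- If a Buchsbaum tangent cone is not Cohen–Macaulay, then a pure power of `z` is killed by `x`. -/
theorem OrderBuchsbaum.exists_pow (hB : OrderBuchsbaum x y z) (hxy : x < y) (hyz : y < z)
    (hR : ¬ OrderRegular x y z) :
    ∃ b m, x + (m + 1) * z = b * y ∧ m + 3 ≤ b ∧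
      ¬ LongSum x y z ((m + 1) * z) (m + 2) ∧
      LongSum x y z ((m + 1) * z + y) (m + 3) ∧ LongSum x y z ((m + 1) * z + z) (m + 3) := by
  simp only [OrderRegular, not_forall] at hR
  obtain ⟨p, q, r, hx, hn⟩ := hR
  obtain ⟨-, hy, hz⟩ := hB p q r 1 hn (by simpa using hx)
  obtain _ | p := p
  swap
  · exfalso
    -- If X divided the witness, the quotient would be killed by X^2, hence by X, so the witness
    -- itself would vanish.
    have h1 : ¬ LongSum x y z (p * x + q * y + r * z) (p + q + r + 1) := fun h =>
      hn (by convert h.add_left using 1 <;> ring)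
    have h2 := (hB p q r 2 h1 (by convert hx using 1 <;> ring)).1
    exact hn (by convert h2 using 1 <;> ring)
  simp only [zero_mul, zero_add] at hx hy hz hn
  obtain ⟨p1, q1, r1, h1, h2⟩ := hx
  obtain _ | p1 := p1
  swap
  · exact absurd ⟨p1, q1, r1, by linarith, by omega⟩ hn
  -- A factor common to both sides can be cancelled: the smaller monomial is still killed by X,
  -- hence by that factor as well, so the witness would vanish. The same argument applies to z
  -- below.
  have hq : q = 0 ∨ q1 = 0 := by
    by_contra! h
    obtain ⟨q, rfl⟩ := Nat.exists_eq_succ_of_ne_zero h.1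
    obtain ⟨q1, rfl⟩ := Nat.exists_eq_succ_of_ne_zero h.2
    have h3 : ¬ LongSum x y z (0 * x + q * y + r * z) (0 + q + r + 1) := fun h =>
      hn (by convert h.add_middle using 1 <;> grind)
    have h4 := (hB 0 q r 1 h3 ⟨0, q1, r1, by grind, by omega⟩).2.1
    exact hn (by convert h4 using 1 <;> grind)
  have hr : r = 0 ∨ r1 = 0 := by
    by_contra! h
    obtain ⟨r, rfl⟩ := Nat.exists_eq_succ_of_ne_zero h.1
    obtain ⟨r1, rfl⟩ := Nat.exists_eq_succ_of_ne_zero h.2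
    have h3 : ¬ LongSum x y z (0 * x + q * y + r * z) (0 + q + r + 1) := fun h =>
      hn (by convert h.add_right using 1 <;> grind)
    have h4 := (hB 0 q r 1 h3 ⟨0, q1, r1, by grind, by omega⟩).2.2
    exact hn (by convert h4 using 1 <;> grind)
  by_cases hr1 : r1 = 0
  · subst hr1
    have hq0 : q = 0 := by omega
    subst hq0
    obtain _ | m := r
    · exfalso
      have : 2 * y ≤ q1 * y := Nat.mul_le_mul_right _ (by omega)
      omega
    · exact ⟨q1, m, by linarith, by omega, by simpa using hn, by simpa [add_assoc] using hy,
        by simpa [add_assoc] using hz⟩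
  · exfalso
    obtain rfl : r = 0 := by omega
    obtain rfl | rfl := hq
    · have : 1 * z ≤ r1 * z := Nat.mul_le_mul_right _ (by omega)
      omega
    · have h3 : (q + 2) * z ≤ r1 * z := Nat.mul_le_mul_right _ (by omega)
      have h4 : q * y ≤ q * z := Nat.mul_le_mul_left _ hyz.le
      linarith

/-- That Y and Z kill Z^(m+1) gives longer factorizations of (m+1)z + y and (m+2)z. These cannot
contain y and z respectively, and comparison with x + (m+1)z = by turns both into relations whose
right side is a multiple of x. -/
theorem OrderBuchsbaum.exceptionalRelations (hB : OrderBuchsbaum x y z) (hx : 0 < x)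
    (hxy : x < y) (hyz : y < z) (hymin : ∀ u v, y ≠ u * x + v * z)
    (hzmin : ∀ u v, z ≠ u * x + v * y) (hR : ¬ OrderRegular x y z) :
    ∃ a b m, ExceptionalRelations x y z a b m := by
  obtain ⟨b, m, hb, hmb, hn, hy, hz⟩ := hB.exists_pow hxy hyz hR
  have z_min : ∀ j u v, j ≤ m + 1 → j * z = u * x + v * y → j = 0 := by
    intro j u v hj h
    by_contra hj0
    obtain ⟨w, hw⟩ := exists_add_of_le hj
    have hlen : j < u + v := by
      by_contra hle
      have h1 : (u + v) * z ≤ j * z := Nat.mul_le_mul_right _ (by omega)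
      have h2 : u * x ≤ u * z := Nat.mul_le_mul_left _ (by omega)
      have h3 : v * y ≤ v * z := Nat.mul_le_mul_left _ (by omega)
      have h4 : v * y = v * z ∧ u * x = u * z := by
        constructor <;> linarith
      have hu : u = 0 := by
        by_contra hu
        exact absurd (Nat.eq_of_mul_eq_mul_left (Nat.pos_of_ne_zero hu) h4.2) (by omega)
      have hv : v = 0 := by
        by_contra hv
        exact absurd (Nat.eq_of_mul_eq_mul_left (Nat.pos_of_ne_zero hv) h4.1) (by omega)
      subst hu hv
      have : 0 < j * z := Nat.mul_pos (by omega) (by omega)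
      omega
    exact hn ⟨u, v, w, by rw [hw]; linarith, by omega⟩
  obtain ⟨p2, q2, r2, h1, h2⟩ := hy
  obtain _ | q2 := q2
  swap
  · exact absurd ⟨p2, q2, r2, by linarith, by omega⟩ hn
  obtain ⟨p3, q3, r3, h3, h4⟩ := hz
  obtain _ | r3 := r3
  swap
  · exact absurd ⟨p3, q3, r3, by linarith, by omega⟩ hn
  have hr2 : r2 < m + 1 := by
    by_contra hle
    obtain ⟨w, rfl⟩ := exists_add_of_le (not_lt.1 hle)
    exact hymin p2 w (by linarith)
  obtain ⟨j, rfl⟩ : ∃ j, m = r2 + j := exists_add_of_le (by omega)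
  have hq3 : q3 < b := by
    by_contra hle
    obtain ⟨w, rfl⟩ := exists_add_of_le (not_lt.1 hle)
    exact hzmin (p3 + 1) w (by linarith)
  obtain ⟨i, rfl⟩ : ∃ i, b = q3 + (i + 1) := by
    obtain ⟨i, hi⟩ := exists_add_of_le (Nat.succ_le_of_lt hq3)
    exact ⟨i, by omega⟩
  have e1 : y + (j + 1) * z = p2 * x := by linarith
  have e2 : (i + 1) * y + z = (p3 + 1) * x := by linarith
  -- Subtracting `e1` and `e2` in either order expresses a small multiple of z through x and y,
  -- which `z_min` forbids unless both relations are y + z = ax.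
  have key : i = 0 ∧ j = 0 := by
    rcases le_or_gt (p3 + 1) p2 with h | h
    · obtain ⟨w, rfl⟩ := exists_add_of_le h
      have e3 : j * z = w * x + i * y := by linarith
      have hj := z_min j w i (by omega) e3
      subst hj
      refine ⟨?_, rfl⟩
      by_contra hi
      have : 0 < i * y := Nat.mul_pos (by omega) (by omega)
      omega
    · exfalso
      obtain ⟨w, rfl⟩ : ∃ w, p3 = p2 + w := exists_add_of_le (by omega)
      have e3 : (r2 + 1) * z = w * x + (q3 + 1) * y := by linarith
      have := z_min (r2 + 1) w (q3 + 1) (by omega) e3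
      omega
  obtain ⟨rfl, rfl⟩ := key
  refine ⟨p2, q3 + 1, r2, hx, hxy, hyz, by linarith, by linarith, by omega, ?_, z_min⟩
  -- If b > a + m, then mz + (a+1)x = (b+1)y shows that X^(a+1) kills Z^m. By the Buchsbaum property
  -- Z kills it too, contrary to `hn`.
  by_contra hlt
  have h5 : ¬ LongSum x y z (0 * x + 0 * y + r2 * z) (0 + 0 + r2 + 1) := fun h =>
    hn (by convert h.add_right using 1 <;> ring)
  have h6 := (hB 0 0 r2 (p2 + 1) h5 ⟨0, q3 + 2, 0, by linarith, by omega⟩).2.2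
  exact hn (by convert h6 using 1 <;> ring)

namespace ExceptionalRelations

variable {a b m : ℕ}

theorem three_le_a (h : ExceptionalRelations x y z a b m) : 3 ≤ a := by
  by_contra hlt
  have h1 : a * x ≤ 2 * x := Nat.mul_le_mul_right _ (by omega)
  have := h.yz
  have := h.x_lt_y
  have := h.y_lt_z
  omega

theorem zz (h : ExceptionalRelations x y z a b m) : (m + 2) * z + x + y = a * x + b * y := by
  have := h.yz
  have := h.xz
  linarith

/-- For v ≤ m+1 and u > 0, subtract from x + (m+1)z = by to contradict `z_min`; for u = 0 apply
`z_min` directly. For v ≥ m+2, the relation (m+2)z = (a-1)x + (b-1)y makes the right side too large.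
-/
theorem y_min (h : ExceptionalRelations x y z a b m) (j u v : ℕ) (hj : j < b)
    (hw : j * y = u * x + v * z) : j = 0 := by
  have hx := h.x_pos
  have hxy := h.x_lt_y
  have hyz := h.y_lt_z
  have ha := h.three_le_a
  obtain ⟨w, rfl⟩ : ∃ w, b = j + (w + 1) := by
    obtain ⟨w, hw⟩ := exists_add_of_le (Nat.succ_le_of_lt hj)
    exact ⟨w, by omega⟩
  rcases le_or_gt v (m + 1) with hv | hv
  · obtain ⟨t, ht⟩ := exists_add_of_le hv
    have hxz := h.xz
    rw [ht] at hxz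
    obtain _ | u := u
    · have := h.z_min v 0 j hv (by linarith)
      subst this
      by_contra hj0
      have : 0 < j * y := Nat.mul_pos (by omega) (by omega)
      omega
    · have e : t * z = u * x + (w + 1) * y := by linarith
      have ht0 := h.z_min t u (w + 1) (by omega) e
      subst ht0
      have : 0 < (w + 1) * y := Nat.mul_pos (by omega) (by omega)
      omega
  · exfalso
    obtain ⟨t, rfl⟩ : ∃ t, v = m + 2 + t := exists_add_of_le hv
    obtain ⟨a, rfl⟩ := exists_add_of_le ha
    have hzz := h.zz
    have : (2 + a) * x + u * x + w * y + t * z = 0 := by linarith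
    have : 0 < (2 + a) * x := Nat.mul_pos (by omega) hx
    omega

/-- The exponents of the standard monomials of the tangent cone in the exceptional case. -/
def IsStandard (b m p q v : ℕ) : Prop :=
  (v = 0 ∧ q ≤ b) ∨ (q = 0 ∧ v ≤ m) ∨ (p = 0 ∧ q = 0 ∧ v = m + 1)

/-- Rewrite by YZ → X^a, XZ^(m+1) → Y^b, Z^(m+2) → X^(a-1)Y^(b-1), Y^(b+1) → X^(a+1)Z^m. No rule
shortens a factorization, by 3 ≤ a, m+3 ≤ b and b ≤ a+m. -/
theorem exists_standard (h : ExceptionalRelations x y z a b m) (p q v : ℕ) :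
    ∃ p' q' v', IsStandard b m p' q' v' ∧ p' * x + q' * y + v' * z = p * x + q * y + v * z ∧
      p + q + v ≤ p' + q' + v' := by
  -- The weights m+1 for Y and b+1 for Z are chosen so that both Y^(b+1) → X^(a+1)Z^m and XZ^(m+1) →
  -- Y^b decrease the measure.
  have key : ∀ μ p q v, (m + 1) * q + (b + 1) * v = μ → ∃ p' q' v', IsStandard b m p' q' v' ∧
      p' * x + q' * y + v' * z = p * x + q * y + v * z ∧ p + q + v ≤ p' + q' + v' := by
    intro μ
    induction μ using Nat.strong_induction_on with
    | _ μ ih =>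
      intro p q v hμ
      have step : ∀ p1 q1 v1, (m + 1) * q1 + (b + 1) * v1 < μ →
          p1 * x + q1 * y + v1 * z = p * x + q * y + v * z → p + q + v ≤ p1 + q1 + v1 →
          ∃ p' q' v', IsStandard b m p' q' v' ∧
            p' * x + q' * y + v' * z = p * x + q * y + v * z ∧ p + q + v ≤ p' + q' + v' := by
        intro p1 q1 v1 h1 h2 h3
        obtain ⟨p', q', v', h4, h5, h6⟩ := ih _ h1 p1 q1 v1 rfl
        exact ⟨p', q', v', h4, h5.trans h2, h3.trans h6⟩
      have ha := h.three_le_a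
      have hyz := h.yz
      have hxz := h.xz
      have hzz := h.zz
      have hb := h.le_b
      have hba := h.b_le
      by_cases hS : IsStandard b m p q v
      · exact ⟨p, q, v, hS, rfl, le_rfl⟩
      by_cases hv : v = 0
      · subst hv
        obtain ⟨t, rfl⟩ : ∃ t, q = b + 1 + t := by
          refine exists_add_of_le ?_
          by_contra hq
          exact hS (Or.inl ⟨rfl, by omega⟩)
        exact step (p + a + 1) t m (by rw [← hμ]; nlinarith) (by linarith) (by omega)
      by_cases hq : q = 0
      · subst hq
        rcases lt_trichotomy v (m + 1) with hvm | rfl | hvm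
        · exact absurd (Or.inr (Or.inl ⟨rfl, by omega⟩)) hS
        · obtain _ | p := p
          · exact absurd (Or.inr (Or.inr ⟨rfl, rfl, rfl⟩)) hS
          · exact step p b 0 (by rw [← hμ]; nlinarith) (by linarith) (by omega)
        · obtain ⟨t, rfl⟩ : ∃ t, v = m + 2 + t := exists_add_of_le hvm
          obtain ⟨a, rfl⟩ := exists_add_of_le ha
          obtain ⟨b, rfl⟩ := exists_add_of_le hb
          exact step (p + a + 2) (m + 2 + b) t (by rw [← hμ]; nlinarith) (by linarith) (by omega)
      · obtain ⟨q, rfl⟩ := Nat.exists_eq_succ_of_ne_zero hq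
        obtain ⟨v, rfl⟩ := Nat.exists_eq_succ_of_ne_zero hv
        exact step (p + a) q v (by rw [← hμ]; nlinarith)
          (by simp only [Nat.succ_eq_add_one]; linarith) (by omega)
  exact key _ p q v rfl

/-- After cancellation, two standard monomials of equal weight give a relation isolating a multiple
of y or z, and `y_min`, `z_min` make it trivial. The borderline multiple by is handled by the
relation for x + (m+1)z. -/
theorem standard_unique_of_le (h : ExceptionalRelations x y z a b m) {p q v p' q' v' : ℕ}
    (hS : IsStandard b m p q v) (hS' : IsStandard b m p' q' v')
    (hw : p * x + q * y + v * z = p' * x + q' * y + v' * z) (hp : p ≤ p') :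
    p = p' ∧ q = q' ∧ v = v' := by
  have hx := h.x_pos
  have hxy := h.x_lt_y
  have hyz := h.y_lt_z
  have hxz := h.xz
  obtain ⟨w, rfl⟩ := exists_add_of_le hp
  have pos : ∀ t, 0 < t → 0 < t * x ∧ 0 < t * y ∧ 0 < t * z := fun t ht =>
    ⟨Nat.mul_pos ht (by omega), Nat.mul_pos ht (by omega), Nat.mul_pos ht (by omega)⟩
  have zero : ∀ t1 t2, t1 * x + t2 * y = 0 → t1 = 0 ∧ t2 = 0 := by
    intro t1 t2 ht
    constructor
    · by_contra h0
      have := (pos t1 (by omega)).1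
      omega
    · by_contra h0
      have := (pos t2 (by omega)).2.1
      omega
  have zero' : ∀ t1 t2, t1 * x + t2 * z = 0 → t1 = 0 ∧ t2 = 0 := by
    intro t1 t2 ht
    constructor
    · by_contra h0
      have := (pos t1 (by omega)).1
      omega
    · by_contra h0
      have := (pos t2 (by omega)).2.2
      omega
  by_cases hv : v = 0
  · subst hv
    have hq : q ≤ b := by
      obtain h1 | h1 | h1 := hS <;> omega
    have hqq : q' ≤ q := by
      by_contra hlt
      obtain ⟨t, rfl⟩ := exists_add_of_le (not_le.1 hlt).le
      have := (pos t (by omega)).2.1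
      have : w * x + t * y + v' * z = 0 := by linarith
      omega
    obtain ⟨t, rfl⟩ := exists_add_of_le hqq
    have e : t * y = w * x + v' * z := by linarith
    by_cases ht : t < b
    · have ht0 := h.y_min t w v' ht e
      subst ht0
      obtain ⟨h1, h2⟩ := zero' w v' (by omega)
      omega
    · exfalso
      obtain ⟨rfl, rfl⟩ : q' = 0 ∧ t = b := by omega
      have hvm : v' ≤ m ∨ (p + w = 0 ∧ v' = m + 1) := by
        obtain h1 | h1 | h1 := hS' <;> omega
      have hle : v' ≤ m + 1 := by omega
      obtain ⟨s, hs⟩ := exists_add_of_le hle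
      rw [hs] at hxz
      obtain _ | w := w
      · have := pos s
        have : x + s * z = 0 := by linarith
        omega
      · have e2 : s * z = w * x + 0 * y := by linarith
        have := h.z_min s w 0 (by omega) e2
        omega
  · have hq : q = 0 ∧ v ≤ m + 1 := by
      obtain h1 | h1 | h1 := hS <;> omega
    obtain ⟨rfl, hvm⟩ := hq
    have hvv : v' ≤ v := by
      by_contra hlt
      obtain ⟨t, rfl⟩ := exists_add_of_le (not_le.1 hlt).le
      have := (pos t (by omega)).2.2
      have : w * x + q' * y + t * z = 0 := by linarith
      omega
    obtain ⟨t, rfl⟩ := exists_add_of_le hvv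
    have e : t * z = w * x + q' * y := by linarith
    have ht0 := h.z_min t w q' (by omega) e
    subst ht0
    obtain ⟨h1, h2⟩ := zero w q' (by omega)
    omega

theorem standard_unique (h : ExceptionalRelations x y z a b m) {p q v p' q' v' : ℕ}
    (hS : IsStandard b m p q v) (hS' : IsStandard b m p' q' v')
    (hw : p * x + q * y + v * z = p' * x + q' * y + v' * z) :
    p = p' ∧ q = q' ∧ v = v' := by
  rcases le_total p p' with hp | hp
  · exact h.standard_unique_of_le hS hS' hw hp
  · obtain ⟨h1, h2, h3⟩ := h.standard_unique_of_le hS' hS hw.symm hp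
    exact ⟨h1.symm, h2.symm, h3.symm⟩

theorem not_longSum_of_standard (h : ExceptionalRelations x y z a b m) {p q v : ℕ}
    (hS : IsStandard b m p q v) :
    ¬ LongSum x y z (p * x + q * y + v * z) (p + q + v + 1) := by
  rintro ⟨p1, q1, v1, h1, h2⟩
  obtain ⟨p2, q2, v2, h3, h4, h5⟩ := h.exists_standard p1 q1 v1
  obtain ⟨rfl, rfl, rfl⟩ := h.standard_unique hS h3 (h4.trans h1).symm
  omega

/-- The four rewriting rules of `exists_standard` give the generators: the first three strictly
increase length, so only their left-hand monomials survive in K. -/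
theorem exists_generators (k : Type*) [Field k] (n : Fin 3 → ℕ+)
    (h : ExceptionalRelations (n 0) (n 1) (n 2) a b m) :
    ∃ s : Finset (MvPolynomial (Fin 3) k), s.card ≤ 4 ∧
      Ideal.span (s : Set (MvPolynomial (Fin 3) k)) = RingHom.ker (tangentConeEval k n) := by
  classical
  have ha := h.three_le_a
  have hyz := h.yz
  have hxz := h.xz
  have hzz := h.zz
  have hb := h.le_b
  have hba := h.b_le
  -- The rule for Y^(b+1) preserves degree exactly when b = a + m; then the generator is a binomial,
  -- otherwise a monomial.
  obtain ⟨G, hG, hG'⟩ : ∃ G ∈ RingHom.ker (tangentConeEval k n), triMonomial k 0 (b + 1) 0 = G ∨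
      triMonomial k 0 (b + 1) 0 - triMonomial k (a + 1) 0 m = G := by
    by_cases hlt : b = a + m
    · refine ⟨_, triMonomial_sub_mem_ker k n ?_ ?_, Or.inr rfl⟩
      · omega
      · linarith
    · refine ⟨_, ?_, Or.inl rfl⟩
      rw [triMonomial_mem_ker_iff]
      exact ⟨a + 1, 0, m, by linarith, by omega⟩
  have h1 : triMonomial k 0 1 1 ∈ RingHom.ker (tangentConeEval k n) := by
    rw [triMonomial_mem_ker_iff]
    exact ⟨a, 0, 0, by linarith, by omega⟩
  have h2 : triMonomial k 1 0 (m + 1) ∈ RingHom.ker (tangentConeEval k n) := by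
    rw [triMonomial_mem_ker_iff]
    exact ⟨0, b, 0, by linarith, by omega⟩
  have h3 : triMonomial k 0 0 (m + 2) ∈ RingHom.ker (tangentConeEval k n) := by
    rw [triMonomial_mem_ker_iff]
    obtain ⟨a, rfl⟩ := exists_add_of_le ha
    obtain ⟨b, rfl⟩ := exists_add_of_le hb
    exact ⟨2 + a, m + 2 + b, 0, by linarith, by omega⟩
  refine ⟨{triMonomial k 0 1 1, triMonomial k 1 0 (m + 1), triMonomial k 0 0 (m + 2), G},
    Finset.card_le_four, ?_⟩
  refine ker_tangentConeEval_eq_of_normal_form k n _ ?_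
    {c | IsStandard b m (c 0) (c 1) (c 2)} (fun c => c 1 + c 2) ?_ ?_ ?_
  · rw [Ideal.span_le]
    intro F hF
    simp only [Finset.coe_insert, Finset.coe_singleton, Set.mem_insert_iff,
      Set.mem_singleton_iff] at hF
    obtain rfl | rfl | rfl | rfl := hF
    exacts [h1, h2, h3, hG]
  · set K := Ideal.span ((({triMonomial k 0 1 1, triMonomial k 1 0 (m + 1),
      triMonomial k 0 0 (m + 2), G} : Finset (MvPolynomial (Fin 3) k))) :
        Set (MvPolynomial (Fin 3) k)) with hK
    have g1 : triMonomial k 0 1 1 ∈ K := Ideal.subset_span (by simp)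
    have g2 : triMonomial k 1 0 (m + 1) ∈ K := Ideal.subset_span (by simp)
    have g3 : triMonomial k 0 0 (m + 2) ∈ K := Ideal.subset_span (by simp)
    have g4 : G ∈ K := Ideal.subset_span (by simp)
    have mul : ∀ p q r p' q' r', triMonomial k p q r ∈ K →
        triMonomial k (p' + p) (q' + q) (r' + r) ∈ K := fun p q r p' q' r' hm => by
      rw [← triMonomial_mul]
      exact Ideal.mul_mem_left _ _ hm
    rw [forall_expVec]
    intro p q v hS
    have hS : ¬ IsStandard b m p q v := hS
    by_cases hv : v = 0
    · subst hv
      obtain ⟨t, rfl⟩ : ∃ t, q = t + (b + 1) := by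
        refine Nat.exists_eq_add_of_le' ?_
        by_contra hq
        exact hS (Or.inl ⟨rfl, by omega⟩)
      have g5 := K.mul_mem_left (triMonomial k p t 0) g4
      obtain hG' | hG' := hG'
      · left
        rw [← hG', triMonomial_mul] at g5
        exact g5
      · right
        rw [← hG', mul_sub, triMonomial_mul, triMonomial_mul] at g5
        refine ⟨_, g5, ?_⟩
        change t + 0 + (0 + m) < t + (b + 1) + 0
        omega
    · left
      by_cases hq : q = 0
      · subst hq
        by_cases hvm : v = m + 1
        · subst hvm
          obtain _ | p := p
          · exact absurd (Or.inr (Or.inr ⟨rfl, rfl, rfl⟩)) hS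
          · simpa using mul _ _ _ p 0 0 g2
        · obtain ⟨t, rfl⟩ : ∃ t, v = t + (m + 2) := by
            refine Nat.exists_eq_add_of_le' ?_
            by_contra hlt
            exact hS (Or.inr (Or.inl ⟨rfl, by omega⟩))
          simpa using mul _ _ _ p 0 t g3
      · obtain ⟨q, rfl⟩ := Nat.exists_eq_succ_of_ne_zero hq
        obtain ⟨v, rfl⟩ := Nat.exists_eq_succ_of_ne_zero hv
        simpa using mul _ _ _ p q v g1
  · rw [forall_expVec]
    intro p q v hS hl
    rw [longFactorization_iff, expWeight_expVec, degree_expVec] at hl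
    exact h.not_longSum_of_standard hS hl
  · rw [forall_expVec]
    intro p q v hS
    rw [forall_expVec]
    intro p' q' v' hS' _ hw
    rw [expWeight_expVec, expWeight_expVec] at hw
    obtain ⟨rfl, rfl, rfl⟩ := h.standard_unique hS hS' hw
    rfl

end ExceptionalRelations

end ExceptionalCase

/-! ### Pseudo-Frobenius numbers and the Gorenstein property. -/

section Gorenstein

variable (k : Type*) [Field k] {d : ℕ} {n : Fin d → ℕ+}

theorem LongFactorization.one_of_pos {s : ℕ} (h : LongFactorization n s 0) (hs : 0 < s) :
    LongFactorization n s 1 := by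
  obtain ⟨a, rfl, -⟩ := h
  refine ⟨a, rfl, Nat.one_le_iff_ne_zero.2 fun h0 => hs.ne' ?_⟩
  rw [(Finsupp.degree_eq_zero_iff a).1 h0, map_zero]

variable (n) in
/-- `f` is a pseudo-Frobenius number of the semigroup generated by the `n_i`. -/
def IsPseudoFrobenius (f : ℕ) : Prop :=
  ¬ LongFactorization n f 0 ∧ ∀ i, LongFactorization n (f + n i) 0

theorem IsPseudoFrobenius.longFactorization_add {f s : ℕ} (hf : IsPseudoFrobenius n f)
    (hs : LongFactorization n s 1) : LongFactorization n (s + f) 0 := by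
  obtain ⟨i, hi, h⟩ := hs.exists_sub
  convert h.add (hf.2 i) using 1
  omega

theorem IsPseudoFrobenius.exists_mul {f : ℕ} (hf : IsPseudoFrobenius n f)
    {u : NumSemigroupRing k n} (hu : u ∈ IsLocalRing.maximalIdeal (NumSemigroupRing k n)) :
    ∃ w : NumSemigroupRing k n, (w : PowerSeries k) = PowerSeries.X ^ f * (u : PowerSeries k) := by
  refine ⟨⟨_, (mem_numSemigroupRing_iff k n _).2 fun s hs => ?_⟩, rfl⟩
  rw [PowerSeries.coeff_X_pow_mul'] at hs
  by_cases hfs : f ≤ s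
  · rw [if_pos hfs] at hs
    rw [← orderIdeal_one] at hu
    have := hf.longFactorization_add (hu _ hs)
    rwa [Nat.sub_add_cancel hfs] at this
  · rw [if_neg hfs] at hs
    exact absurd rfl hs

/-- Dividing an element of the intersection by r gives g + t^f h = g' + t^f' h'. Once h is known to
lie in 𝔪, t^f h belongs to R and the element is a multiple of r. -/
theorem IsPseudoFrobenius.inf_le {f f' : ℕ} (hf : IsPseudoFrobenius n f)
    (hf' : IsPseudoFrobenius n f') (hne : f ≠ f') {r u u' : NumSemigroupRing k n} (hr : r ≠ 0)
    (hu : (u : PowerSeries k) = PowerSeries.X ^ f * (r : PowerSeries k))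
    (hu' : (u' : PowerSeries k) = PowerSeries.X ^ f' * (r : PowerSeries k)) :
    Ideal.span {r, u} ⊓ Ideal.span {r, u'} ≤ Ideal.span {r} := by
  rintro x ⟨hx, hx'⟩
  obtain ⟨g, h, rfl⟩ := Ideal.mem_span_pair.1 hx
  obtain ⟨g', h', he⟩ := Ideal.mem_span_pair.1 hx'
  have hr' : (r : PowerSeries k) ≠ 0 := fun h0 => hr (Subtype.ext h0)
  have he' : (g' : PowerSeries k) + PowerSeries.X ^ f' * (h' : PowerSeries k) =
      (g : PowerSeries k) + PowerSeries.X ^ f * (h : PowerSeries k) := by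
    have h1 : (g' : PowerSeries k) * r + h' * u' = g * r + h * u := congrArg Subtype.val he
    rw [hu, hu'] at h1
    refine mul_right_cancel₀ hr' ?_
    linear_combination h1
  have hgap : ∀ w : NumSemigroupRing k n, PowerSeries.coeff f (w : PowerSeries k) = 0 := by
    intro w
    by_contra hw
    exact hf.1 ((mem_numSemigroupRing_iff k n _).1 w.2 f hw)
  -- Compare coefficients of t^f: g and g' have none there, and a term of h' in degree f - f' > 0
  -- would put f in the semigroup.
  have hh : h ∈ IsLocalRing.maximalIdeal (NumSemigroupRing k n) := by
    rw [mem_maximalIdeal_numSemigroupRing_iff]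
    have h1 := congrArg (PowerSeries.coeff f) he'
    rw [map_add, map_add, hgap, hgap, zero_add, zero_add, PowerSeries.coeff_X_pow_mul',
      PowerSeries.coeff_X_pow_mul', if_pos le_rfl, Nat.sub_self] at h1
    rw [← h1]
    split_ifs with hle
    · by_contra h2
      have h3 := (mem_numSemigroupRing_iff k n _).1 h'.2 _ h2
      have h4 := hf'.longFactorization_add (h3.one_of_pos (by omega))
      rw [Nat.sub_add_cancel hle] at h4
      exact hf.1 h4
    · rfl
  obtain ⟨w, hw⟩ := hf.exists_mul k hh
  rw [Ideal.mem_span_singleton']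
  refine ⟨g + w, Subtype.ext ?_⟩
  change ((g : PowerSeries k) + (w : PowerSeries k)) * r = g * r + h * u
  rw [hw, hu]
  ring

theorem IsPseudoFrobenius.not_mem_span {f : ℕ} (hf : IsPseudoFrobenius n f)
    {r u : NumSemigroupRing k n} (hr : r ≠ 0)
    (hu : (u : PowerSeries k) = PowerSeries.X ^ f * (r : PowerSeries k)) :
    u ∉ Ideal.span {r} := by
  intro h
  obtain ⟨c, rfl⟩ := Ideal.mem_span_singleton'.1 h
  have hr' : (r : PowerSeries k) ≠ 0 := fun h0 => hr (Subtype.ext h0)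
  have hc : (c : PowerSeries k) = PowerSeries.X ^ f := mul_right_cancel₀ hr' hu
  refine hf.1 ((mem_numSemigroupRing_iff k n _).1 c.2 f ?_)
  rw [hc, PowerSeries.coeff_X_pow, if_pos rfl]
  exact one_ne_zero

/-- If the semigroup has two different pseudo-Frobenius numbers, then no nonzero principal ideal
contained in the maximal ideal of the semigroup ring is irreducible. -/
theorem IsPseudoFrobenius.not_infIrred {f f' : ℕ} (hf : IsPseudoFrobenius n f)
    (hf' : IsPseudoFrobenius n f') (hne : f ≠ f') {r : NumSemigroupRing k n} (hr : r ≠ 0)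
    (hrm : r ∈ IsLocalRing.maximalIdeal (NumSemigroupRing k n)) :
    ¬ InfIrred (Ideal.span {r}) := by
  intro hirr
  obtain ⟨u, hu⟩ := hf.exists_mul k hrm
  obtain ⟨u', hu'⟩ := hf'.exists_mul k hrm
  have h1 : Ideal.span {r, u} ⊓ Ideal.span {r, u'} = Ideal.span {r} := by
    apply le_antisymm (hf.inf_le k hf' hne hr hu hu')
    exact le_inf (Ideal.span_mono (by simp)) (Ideal.span_mono (by simp))
  obtain h2 | h2 := hirr.2 h1
  · exact hf.not_mem_span k hr hu (h2 ▸ Ideal.subset_span (by simp))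
  · exact hf'.not_mem_span k hr hu' (h2 ▸ Ideal.subset_span (by simp))

theorem exists_conductor (hgcd : Finset.univ.gcd (fun i => (n i : ℕ)) = 1) :
    ∃ c, ∀ s ≥ c, LongFactorization n s 0 := by
  obtain ⟨c, hc⟩ := Nat.exists_mem_closure_of_ge (Set.range fun i => (n i : ℕ))
  refine ⟨c, fun s hs => ?_⟩
  have h1 : Nat.setGcd (Set.range fun i => (n i : ℕ)) ∣ s := by
    have : Nat.setGcd (Set.range fun i => (n i : ℕ)) ∣ 1 := by
      rw [← hgcd]
      exact Finset.dvd_gcd fun i _ => Nat.setGcd_dvd_of_mem ⟨i, rfl⟩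
    exact this.trans (one_dvd _)
  have h2 := hc s hs h1
  clear h1 hs hc
  induction h2 using AddSubmonoid.closure_induction with
  | mem x hx =>
    obtain ⟨i, rfl⟩ := hx
    exact (longFactorization_gen i).mono (Nat.zero_le _)
  | zero => exact longFactorization_zero
  | add x y _ _ hx hy => exact hx.add hy

/-- If r has t-order v and c bounds the conductor, r'^(v+c)/r lies in t^c k[[t]], which is contained
in R. -/
theorem exists_pow_mem_span (hgcd : Finset.univ.gcd (fun i => (n i : ℕ)) = 1)
    {r r' : NumSemigroupRing k n} (hr : r ≠ 0)
    (hr' : r' ∈ IsLocalRing.maximalIdeal (NumSemigroupRing k n)) :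
    ∃ N, r' ^ N ∈ Ideal.span {r} := by
  obtain ⟨c, hc⟩ := exists_conductor hgcd
  have hr0 : (r : PowerSeries k) ≠ 0 := fun h0 => hr (Subtype.ext h0)
  obtain ⟨v, w, hw⟩ := IsDiscreteValuationRing.associated_pow_irreducible hr0
    (PowerSeries.X_irreducible (R := k))
  rw [mem_maximalIdeal_numSemigroupRing_iff, PowerSeries.coeff_zero_eq_constantCoeff_apply,
    ← PowerSeries.X_dvd_iff] at hr'
  obtain ⟨q, hq⟩ := hr'
  refine ⟨v + c, Ideal.mem_span_singleton'.2 ⟨⟨(w : PowerSeries k) * PowerSeries.X ^ c * q ^ (v + c),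
    (mem_numSemigroupRing_iff k n _).2 fun s hs => hc s ?_⟩, Subtype.ext ?_⟩⟩
  · by_contra hlt
    refine hs ?_
    rw [mul_right_comm, mul_comm, PowerSeries.coeff_X_pow_mul', if_neg hlt]
  · change (w : PowerSeries k) * PowerSeries.X ^ c * q ^ (v + c) * (r : PowerSeries k) =
      (r' : PowerSeries k) ^ (v + c)
    rw [hq, mul_pow, pow_add PowerSeries.X, ← hw]
    ring

theorem not_isField_numSemigroupRing (i : Fin d) : ¬ IsField (NumSemigroupRing k n) := by
  intro h
  have h1 := semigroupGen_mem_maximalIdeal k n i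
  rw [(IsLocalRing.isField_iff_maximalIdeal_eq).1 h, Ideal.mem_bot] at h1
  have h2 : (PowerSeries.X ^ (n i : ℕ) : PowerSeries k) = 0 := congrArg Subtype.val h1
  exact pow_ne_zero _ PowerSeries.X_ne_zero h2

/-- The empty sequence would make the domain R a field. A second term has a power in (r), so it
cannot be regular on the nonzero module R/(r). -/
theorem IsMaxRegularSeq.eq_singleton (i : Fin d)
    (hgcd : Finset.univ.gcd (fun i => (n i : ℕ)) = 1) {rs : List (NumSemigroupRing k n)}
    (h : IsMaxRegularSeq (NumSemigroupRing k n) rs) :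
    ∃ r ∈ IsLocalRing.maximalIdeal (NumSemigroupRing k n), r ≠ 0 ∧ rs = [r] := by
  obtain ⟨hmem, hreg, hlen⟩ := h
  obtain _ | ⟨r, rs⟩ := rs
  · exfalso
    have h1 : Ring.KrullDimLE 0 (NumSemigroupRing k n) :=
      ringKrullDimZero_iff_ringKrullDim_eq_zero.2 (by simpa using hlen.symm)
    exact not_isField_numSemigroupRing k (n := n) i Ring.KrullDimLE.isField_of_isDomain
  · have hr := hmem r (by simp)
    rw [RingTheory.Sequence.isRegular_cons_iff] at hreg
    have hr0 : r ≠ 0 := by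
      rintro rfl
      have h1 : (1 : NumSemigroupRing k n) = 0 := hreg.1 (by simp)
      exact one_ne_zero h1
    refine ⟨r, hr, hr0, ?_⟩
    obtain _ | ⟨r', rs⟩ := rs
    · rfl
    · exfalso
      have h2 := hreg.2
      rw [RingTheory.Sequence.isRegular_cons_iff] at h2
      obtain ⟨N, hN⟩ := exists_pow_mem_span k hgcd hr0 (hmem r' (by simp))
      have h3 := h2.1.pow N
      have h4 : (Submodule.Quotient.mk 1 : QuotSMulTop r (NumSemigroupRing k n)) = 0 := by
        apply h3
        change r' ^ N • _ = r' ^ N • _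
        rw [smul_zero, ← Submodule.Quotient.mk_smul, Submodule.Quotient.mk_eq_zero]
        obtain ⟨c, hc⟩ := Ideal.mem_span_singleton'.1 hN
        refine ⟨c, trivial, ?_⟩
        change r * c = r' ^ N * 1
        rw [← hc]
        ring
      rw [Submodule.Quotient.mk_eq_zero] at h4
      obtain ⟨c, -, hc⟩ := h4
      exact (IsLocalRing.mem_maximalIdeal r).1 hr (IsUnit.of_mul_eq_one c hc)

theorem IsGorensteinLocalRing.pseudoFrobenius_unique (i : Fin d)
    (hgcd : Finset.univ.gcd (fun i => (n i : ℕ)) = 1)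
    (hG : IsGorensteinLocalRing (NumSemigroupRing k n)) {f f' : ℕ}
    (hf : IsPseudoFrobenius n f) (hf' : IsPseudoFrobenius n f') : f = f' := by
  obtain ⟨-, rs, hrs, hirr⟩ := hG
  obtain ⟨r, hr, hr0, rfl⟩ := hrs.eq_singleton k i hgcd
  rw [Ideal.ofList_singleton] at hirr
  by_contra hne
  exact hf.not_infIrred k hf' hne hr0 hr hirr

/-- The numbers are (b-1)y - x and (m+1)z - x. Adding a generator lands in the semigroup by the
three relations; `y_min` and `z_min` keep the numbers themselves outside it and distinct. -/
theorem ExceptionalRelations.exists_pseudoFrobenius {n : Fin 3 → ℕ+} {a b m : ℕ}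
    (h : ExceptionalRelations (n 0) (n 1) (n 2) a b m) :
    ∃ f f', IsPseudoFrobenius n f ∧ IsPseudoFrobenius n f' ∧ f ≠ f' := by
  have ha := h.three_le_a
  have hyz := h.yz
  have hxz := h.xz
  have hzz := h.zz
  have hb := h.le_b
  have hxy := h.x_lt_y
  have hyz' := h.y_lt_z
  have hx := h.x_pos
  have hymin := h.y_min
  have hzmin := h.z_min
  have forall_three : ∀ P : Fin 3 → Prop, (∀ i, P i) ↔ P 0 ∧ P 1 ∧ P 2 := fun P =>
    ⟨fun h => ⟨h 0, h 1, h 2⟩, fun h i => by fin_cases i; exacts [h.1, h.2.1, h.2.2]⟩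
  simp only [IsPseudoFrobenius, longFactorization_iff, forall_three]
  generalize (n 0 : ℕ) = x at *
  generalize hy : (n 1 : ℕ) = y at *
  generalize hz : (n 2 : ℕ) = z at *
  obtain ⟨b, rfl⟩ := Nat.exists_eq_add_of_le' hb
  obtain ⟨a, rfl⟩ := Nat.exists_eq_add_of_le' ha
  obtain ⟨f, hf⟩ : ∃ f, (b + m + 2) * y = f + x := by
    have : 1 * y ≤ (b + m + 2) * y := Nat.mul_le_mul_right _ (by omega)
    exact Nat.exists_eq_add_of_le' (by omega)
  obtain ⟨f', hf'⟩ : ∃ f, (m + 1) * z = f + x := by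
    have : 1 * z ≤ (m + 1) * z := Nat.mul_le_mul_right _ (by omega)
    exact Nat.exists_eq_add_of_le' (by omega)
  refine ⟨f, f', ⟨?_, ?_⟩, ⟨?_, ?_⟩, ?_⟩
  · rintro ⟨p, q, v, h1, -⟩
    have hq : q ≤ b + m + 2 := by
      by_contra hlt
      have : (b + m + 3) * y ≤ q * y := Nat.mul_le_mul_right _ (by omega)
      have : (b + m + 3) * y = (b + m + 2) * y + y := by ring
      have : 0 ≤ p * x := Nat.zero_le _
      omega
    obtain ⟨t, ht⟩ := Nat.exists_eq_add_of_le' hq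
    have e : t * y = (p + 1) * x + v * z := by
      rw [ht] at hf
      linarith
    have := hymin t (p + 1) v (by omega) e
    subst this
    have : 0 < (p + 1) * x := Nat.mul_pos (by omega) hx
    omega
  · exact ⟨⟨0, b + m + 2, 0, by linarith, Nat.zero_le _⟩,
      ⟨0, 0, m + 1, by linarith, Nat.zero_le _⟩,
      ⟨a + 2, b + m + 1, 0, by linarith, Nat.zero_le _⟩⟩
  · rintro ⟨p, q, v, h1, -⟩
    have hv : v ≤ m + 1 := by
      by_contra hlt
      have : (m + 2) * z ≤ v * z := Nat.mul_le_mul_right _ (by omega)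
      have : (m + 2) * z = (m + 1) * z + z := by ring
      have : 0 ≤ p * x := Nat.zero_le _
      omega
    obtain ⟨t, ht⟩ := Nat.exists_eq_add_of_le' hv
    have e : t * z = (p + 1) * x + q * y := by
      rw [ht] at hf'
      linarith
    have := hzmin t (p + 1) q (by omega) e
    subst this
    have : 0 < (p + 1) * x := Nat.mul_pos (by omega) hx
    omega
  · exact ⟨⟨0, 0, m + 1, by linarith, Nat.zero_le _⟩,
      ⟨a + 2, 0, m, by linarith, Nat.zero_le _⟩,
      ⟨a + 1, b + m + 2, 0, by linarith, Nat.zero_le _⟩⟩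
  · rintro rfl
    have := hzmin (m + 1) 0 (b + m + 2) le_rfl (by linarith)
    omega

end Gorenstein

/-! ### The homogeneous maximal ideal of the tangent cone and an abstract form of its presentation.
-/

section TangentConeMaximalIdeal

variable (k : Type*) [Field k] {d : ℕ} (n : Fin d → ℕ+)

theorem bigradedCoeff_zero_zero (f : MvPolynomial (Fin d) k) :
    bigradedCoeff k n 0 0 f = MvPolynomial.constantCoeff f := by
  classical
  induction f using MvPolynomial.induction_on' with
  | monomial a r =>
    rw [bigradedCoeff_monomial, MvPolynomial.constantCoeff_monomial]
    by_cases ha : a = 0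
    · simp [ha]
    · rw [if_neg ha, if_neg]
      rintro ⟨h, -⟩
      exact ha ((Finsupp.degree_eq_zero_iff a).1 h)
  | add p q hp hq => rw [map_add, map_add, hp, hq]

theorem exists_of_bigradedCoeff_ne_zero {f : MvPolynomial (Fin d) k} {e s : ℕ}
    (h : bigradedCoeff k n e s f ≠ 0) :
    ∃ a ∈ f.support, a.degree = e ∧ expWeight n a = s := by
  by_contra! hne
  apply h
  rw [← MvPolynomial.support_sum_monomial_coeff f, map_sum]
  refine Finset.sum_eq_zero fun a ha => ?_
  rw [bigradedCoeff_monomial, if_neg fun h' => hne a ha h'.1 h'.2]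

theorem bigradedCoeff_X_mul (i : Fin d) (e s : ℕ) (f : MvPolynomial (Fin d) k) :
    bigradedCoeff k n (e + 1) (s + n i) (MvPolynomial.X i * f) = bigradedCoeff k n e s f := by
  induction f using MvPolynomial.induction_on' with
  | monomial a r =>
    rw [MvPolynomial.X, MvPolynomial.monomial_mul, one_mul, bigradedCoeff_monomial,
      bigradedCoeff_monomial, map_add, map_add, expWeight_single, Finsupp.degree_single]
    congr 1
    apply propext
    constructor <;> rintro ⟨h1, h2⟩ <;> constructor <;> omega
  | add p q hp hq => rw [mul_add, map_add, map_add, hp, hq]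

theorem bigradedCoeff_X_pow_mul (i : Fin d) (N : ℕ) (f : MvPolynomial (Fin d) k) :
    bigradedCoeff k n N (N * n i) (MvPolynomial.X i ^ N * f) = MvPolynomial.constantCoeff f := by
  induction N with
  | zero => rw [pow_zero, one_mul, zero_mul, bigradedCoeff_zero_zero]
  | succ N ih => rw [pow_succ', mul_assoc, Nat.succ_mul, bigradedCoeff_X_mul, ih]

theorem tangentConeEval_mem_homogMaxIdeal_iff (f : MvPolynomial (Fin d) k) :
    tangentConeEval k n f ∈ homogMaxIdeal (NumSemigroupRing k n) ↔
      MvPolynomial.constantCoeff f = 0 := by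
  have h1 : ∀ p : reesAlgebra (IsLocalRing.maximalIdeal (NumSemigroupRing k n)),
      (Ideal.Quotient.mk _ p : TangentCone k n) ∈ homogMaxIdeal (NumSemigroupRing k n) ↔
        (p : Polynomial (NumSemigroupRing k n)).coeff 0 ∈
          IsLocalRing.maximalIdeal (NumSemigroupRing k n) := by
    intro p
    rw [homogMaxIdeal, ← Ideal.mem_comap, Ideal.comap_map_mk]
    · rfl
    · rw [Ideal.map_le_iff_le_comap]
      intro a ha
      change (Polynomial.C a).coeff 0 ∈ IsLocalRing.maximalIdeal (NumSemigroupRing k n)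
      rwa [Polynomial.coeff_C_zero]
  rw [tangentConeEval, gradedEval, RingHom.comp_apply, h1, mem_maximalIdeal_numSemigroupRing_iff,
    coeff_coeff_reesEval, bigradedCoeff_zero_zero]

theorem mem_span_X_iff_constantCoeff (f : MvPolynomial (Fin d) k) :
    f ∈ Ideal.span (Set.range MvPolynomial.X) ↔ MvPolynomial.constantCoeff f = 0 := by
  have h := MvPolynomial.mem_pow_idealOfVars_iff' (σ := Fin d) (R := k) 1 f
  rw [pow_one] at h
  rw [h]
  constructor
  · intro h1
    exact h1 0 (by simp)
  · intro h1 a ha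
    have : a = 0 := (Finsupp.degree_eq_zero_iff a).1 (by omega)
    rw [this]
    exact h1

variable {k} in
/-- A surjection `k[X_1, …, X_d] → A` with the kernel of the tangent cone presentation, together
with the ideal of `A` generated by the variables. -/
structure TangentConePresentation {A : Type*} [CommRing A] (φ : MvPolynomial (Fin d) k →+* A)
    (M : Ideal A) : Prop where
  surjective : Function.Surjective φ
  eq_zero_iff : ∀ f, φ f = 0 ↔ ∀ e s, bigradedCoeff k n e s f ≠ 0 → LongFactorization n s (e + 1)
  mem_iff : ∀ f, φ f ∈ M ↔ MvPolynomial.constantCoeff f = 0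

theorem tangentConePresentation :
    TangentConePresentation n (A := TangentCone k n) (tangentConeEval k n)
      (homogMaxIdeal (NumSemigroupRing k n)) where
  surjective := tangentConeEval_surjective k n
  eq_zero_iff := tangentConeEval_eq_zero_iff k n
  mem_iff := tangentConeEval_mem_homogMaxIdeal_iff k n

namespace TangentConePresentation

variable {k} {n} {A : Type*} [CommRing A] {φ : MvPolynomial (Fin d) k →+* A} {M : Ideal A}

theorem eq_span (h : TangentConePresentation n φ M) :
    M = Ideal.span (Set.range fun i => φ (MvPolynomial.X i)) := by
  have h1 : M.comap φ = Ideal.span (Set.range MvPolynomial.X) := by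
    ext f
    rw [Ideal.mem_comap, h.mem_iff, mem_span_X_iff_constantCoeff]
  rw [← Ideal.map_comap_of_surjective _ h.surjective M, h1, Ideal.map_span, ← Set.range_comp]
  rfl

theorem isMaximal (h : TangentConePresentation n φ M) : M.IsMaximal := by
  rw [Ideal.isMaximal_iff]
  constructor
  · rw [← map_one φ, h.mem_iff, map_one]
    exact one_ne_zero
  · intro J x hJ hx hxJ
    obtain ⟨f, rfl⟩ := h.surjective x
    rw [h.mem_iff] at hx
    have h1 : φ (f - MvPolynomial.C (MvPolynomial.constantCoeff f)) ∈ J := by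
      refine hJ ((h.mem_iff _).2 ?_)
      rw [map_sub, MvPolynomial.constantCoeff_C, sub_self]
    rw [map_sub] at h1
    have h2 := J.mul_mem_left (φ (MvPolynomial.C (MvPolynomial.constantCoeff f)⁻¹))
      (sub_mem hxJ h1)
    rwa [sub_sub_cancel, ← map_mul, ← map_mul, inv_mul_cancel₀ hx, map_one, map_one] at h2

theorem isNoetherianRing (h : TangentConePresentation n φ M) : IsNoetherianRing A :=
  isNoetherianRing_of_surjective _ _ φ h.surjective

theorem monomial_eq_zero_iff (h : TangentConePresentation n φ M) (a : Fin d →₀ ℕ) :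
    φ (MvPolynomial.monomial a 1) = 0 ↔
      LongFactorization n (expWeight n a) (a.degree + 1) := by
  rw [h.eq_zero_iff, ← tangentConeEval_eq_zero_iff, tangentConeEval_monomial_eq_zero_iff]

/-- An element of the tangent cone divisible by all powers of a variable vanishes. -/
theorem eq_zero_of_eq_X_mul (h : TangentConePresentation n φ M) (i : Fin d) {a v : A}
    (ha : a = φ (MvPolynomial.X i) * v * a) : a = 0 := by
  have hpow : ∀ N : ℕ, a = φ (MvPolynomial.X i) ^ N * (v ^ N * a) := by
    intro N
    induction N with
    | zero => simp
    | succ N ih =>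
      calc a = φ (MvPolynomial.X i) ^ N * (v ^ N * a) := ih
        _ = φ (MvPolynomial.X i) ^ N * (v ^ N * (φ (MvPolynomial.X i) * v * a)) := by rw [← ha]
        _ = _ := by ring
  obtain ⟨f, rfl⟩ := h.surjective a
  rw [h.eq_zero_iff]
  intro e s hes
  obtain ⟨g, hg⟩ := h.surjective (v ^ (e + 1) * φ f)
  have h1 := hpow (e + 1)
  rw [← hg, ← map_pow, ← map_mul, ← sub_eq_zero, ← map_sub, h.eq_zero_iff] at h1
  refine h1 e s ?_
  -- A multiple of X_i^(e+1) has no terms of degree e, so the bidegree (e, s) part of f already lies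
  -- in the kernel.
  have h2 : bigradedCoeff k n e s (MvPolynomial.X i ^ (e + 1) * g) = 0 := by
    by_contra hne
    obtain ⟨a, ha, hdeg, -⟩ := exists_of_bigradedCoeff_ne_zero k n hne
    have h3 : MvPolynomial.X i ^ (e + 1) * g ∈ MvPolynomial.idealOfVars (Fin d) k ^ (e + 1) :=
      Ideal.mul_mem_right _ _ (Ideal.pow_mem_pow (Ideal.subset_span (Set.mem_range_self i)) _)
    have := (MvPolynomial.mem_pow_idealOfVars_iff _ _).1 h3 a ha
    omega
  rwa [map_sub, h2, sub_zero]

end TangentConePresentation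

end TangentConeMaximalIdeal

/-! ### Zeroth local cohomology, depth and Cohen–Macaulay localizations. -/

section LocalCohomology

theorem mem_localCohomologyZero_of_le_radical {A : Type*} [CommRing A] {M : Ideal A} (hM : M.FG)
    {a : A} (h : M ≤ (Submodule.annihilator (Ideal.span {a})).radical) :
    a ∈ localCohomologyZero M := by
  obtain ⟨N, hN⟩ := Ideal.exists_pow_le_of_le_radical_of_fg h hM
  exact ⟨N, fun r hr => (Submodule.mem_annihilator_span_singleton _ _).1 (hN hr)⟩

/-- If a localization at a maximal ideal `M` has positive depth, then `H⁰_M` vanishes. -/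
theorem localCohomologyZero_eq_bot {A : Type*} [CommRing A] (M : Ideal A) [hM : M.IsMaximal]
    {u : Localization.AtPrime M} (hu : u ∈ IsLocalRing.maximalIdeal (Localization.AtPrime M))
    (hreg : IsSMulRegular (Localization.AtPrime M) u) : localCohomologyZero M = ⊥ := by
  rw [eq_bot_iff]
  rintro a ⟨N, hN⟩
  rw [Ideal.mem_bot]
  have h1 : (M ^ N).map (algebraMap A (Localization.AtPrime M)) ≤
      Submodule.annihilator (Ideal.span {algebraMap A (Localization.AtPrime M) a}) := by
    rw [Ideal.map_le_iff_le_comap]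
    intro r hr
    rw [Ideal.mem_comap, Submodule.mem_annihilator_span_singleton, smul_eq_mul, ← map_mul,
      hN r hr, map_zero]
  rw [Ideal.map_pow, Localization.AtPrime.map_eq_maximalIdeal] at h1
  have h2 := (Submodule.mem_annihilator_span_singleton _ _).1 (h1 (Ideal.pow_mem_pow hu N))
  have h3 : algebraMap A (Localization.AtPrime M) a = 0 := by
    apply hreg.pow N
    change u ^ N • _ = u ^ N • _
    rw [h2, smul_zero]
  rw [IsLocalization.map_eq_zero_iff M.primeCompl] at h3
  obtain ⟨⟨w, hw⟩, hwa⟩ := h3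
  -- The annihilator of a contains M^N, so M is the only maximal ideal that could contain it; it
  -- also contains w, which is not in M.
  have h4 : Submodule.annihilator (Ideal.span {a}) = ⊤ := by
    by_contra hne
    obtain ⟨P, hP, hle⟩ := Ideal.exists_le_maximal _ hne
    have h5 : M ≤ P := by
      intro r hr
      refine hP.isPrime.mem_of_pow_mem N (hle ?_)
      exact (Submodule.mem_annihilator_span_singleton _ _).2 (hN _ (Ideal.pow_mem_pow hr N))
    refine hw ?_
    rw [hM.eq_of_le hP.ne_top h5]
    exact hle ((Submodule.mem_annihilator_span_singleton _ _).2 hwa)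
  have h5 := (Ideal.eq_top_iff_one _).1 h4
  simpa using (Submodule.mem_annihilator_span_singleton _ _).1 h5

/-- The localization of a Noetherian ring at a maximal ideal that is minimal over a nonzerodivisor
is Cohen–Macaulay of dimension one. -/
theorem isCohenMacaulayLocalRing_of_mem_minimalPrimes {A : Type*} [CommRing A] [IsNoetherianRing A]
    (P : Ideal A) [P.IsPrime] {u : A} (hu : u ∈ nonZeroDivisors A)
    (hP : P ∈ (Ideal.span {u}).minimalPrimes) :
    IsCohenMacaulayLocalRing (Localization.AtPrime P) := by
  have : IsNoetherianRing (Localization.AtPrime P) :=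
    IsLocalization.isNoetherianRing P.primeCompl _ inferInstance
  have huP : u ∈ P := hP.1.2 (Ideal.mem_span_singleton_self u)
  set u' := algebraMap A (Localization.AtPrime P) u with hu'
  have hmem : u' ∈ IsLocalRing.maximalIdeal (Localization.AtPrime P) :=
    (IsLocalization.AtPrime.to_map_mem_maximal_iff _ P u).2 huP
  have hnzd : u' ∈ nonZeroDivisors (Localization.AtPrime P) :=
    IsLocalization.map_nonZeroDivisors_le P.primeCompl _ ⟨u, hu, rfl⟩
  have hmem' : ∀ r ∈ [u'], r ∈ IsLocalRing.maximalIdeal (Localization.AtPrime P) := by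
    simpa using hmem
  refine ⟨this, [u'], hmem', ?_, ?_⟩
  · refine RingTheory.Sequence.IsRegular.of_isWeaklyRegular_of_mem_maximalIdeal _ hmem' ?_
    rw [RingTheory.Sequence.isWeaklyRegular_singleton_iff]
    intro a b hab
    exact (mul_cancel_left_mem_nonZeroDivisors hnzd).1 hab
  -- The dimension is at least 1 because u' is a nonunit nonzerodivisor, and at most 1 by Krull's
  -- principal ideal theorem.
  · apply le_antisymm
    · have h1 := ringKrullDim_quotient_succ_le_of_nonZeroDivisor hnzd
      have : Nontrivial (Localization.AtPrime P ⧸ Ideal.span {u'}) := by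
        rw [Ideal.Quotient.nontrivial_iff]
        intro h
        exact (IsLocalRing.mem_maximalIdeal u').1 hmem (Ideal.span_singleton_eq_top.1 h)
      have h2 := ringKrullDim_nonneg_of_nontrivial (R := Localization.AtPrime P ⧸ Ideal.span {u'})
      refine le_trans ?_ h1
      simpa using add_le_add_left h2 1
    · rw [IsLocalization.AtPrime.ringKrullDim_eq_height P (Localization.AtPrime P)]
      have := Ideal.height_le_one_of_isPrincipal_of_mem_minimalPrimes _ P hP
      exact_mod_cast this

end LocalCohomology

/-! ### Buchsbaum and Cohen–Macaulay conditions in terms of factorization lengths. -/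

section ThreeGeneratedTangentCone

variable {k : Type*} [Field k] {n : Fin 3 → ℕ+} {A : Type*} [CommRing A]
  {φ : MvPolynomial (Fin 3) k →+* A} {M : Ideal A}

theorem StrictMono.lt_of_ne_zero (hlt : StrictMono n) {i : Fin 3} (hi : i ≠ 0) : n 0 < n i :=
  hlt (Fin.pos_of_ne_zero hi)

namespace TangentConePresentation

theorem X_pow_mul_monomial (i : Fin 3) (N : ℕ) (a : Fin 3 →₀ ℕ) :
    φ (MvPolynomial.X i) ^ N * φ (MvPolynomial.monomial a 1) =
      φ (MvPolynomial.monomial (Finsupp.single i N + a) 1) := by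
  rw [← map_pow, ← map_mul, MvPolynomial.X_pow_eq_monomial, MvPolynomial.monomial_mul, one_mul]

/-- Trading n_0 copies of n_i for n_i copies of n_0 gives a longer factorization. -/
theorem X_pow_eq_zero (h : TangentConePresentation n φ M) {i : Fin 3} (hi : n 0 < n i) :
    φ (MvPolynomial.X i) ^ (n 0 : ℕ) = 0 := by
  rw [← map_pow, MvPolynomial.X_pow_eq_monomial, h.monomial_eq_zero_iff]
  refine ⟨Finsupp.single 0 (n i), ?_, ?_⟩
  · rw [expWeight_single, expWeight_single, mul_comm]
  · rw [Finsupp.degree_single, Finsupp.degree_single]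
    exact (PNat.coe_lt_coe _ _).2 hi

/-- Since Y and Z are nilpotent, being killed by a power of X already places an element in `H⁰_M`.
-/
theorem X_mul_eq_zero_of_isBuchsbaum (h : TangentConePresentation n φ M) (hlt : StrictMono n)
    (hB : IsBuchsbaum M) {a : Fin 3 →₀ ℕ} {N : ℕ}
    (ha : φ (MvPolynomial.X 0) ^ N * φ (MvPolynomial.monomial a 1) = 0) (i : Fin 3) :
    φ (MvPolynomial.X i) * φ (MvPolynomial.monomial a 1) = 0 := by
  have := h.isNoetherianRing
  have h1 : φ (MvPolynomial.monomial a 1) ∈ localCohomologyZero M := by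
    refine mem_localCohomologyZero_of_le_radical (IsNoetherian.noetherian _) ?_
    rw [h.eq_span, Ideal.span_le]
    rintro _ ⟨j, rfl⟩
    by_cases hj : j = 0
    · subst hj
      exact ⟨N, (Submodule.mem_annihilator_span_singleton _ _).2 ha⟩
    · refine ⟨n 0, ?_⟩
      simp only [h.X_pow_eq_zero (hlt.lt_of_ne_zero hj)]
      exact zero_mem _
  have h2 : φ (MvPolynomial.X i) ∈ M ^ 1 := by
    rw [pow_one, h.mem_iff, MvPolynomial.constantCoeff_X]
  have h3 := Ideal.mul_mem_mul h2 h1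
  have h4 : M ^ 1 * localCohomologyZero M = ⊥ := hB
  rwa [h4, Ideal.mem_bot] at h3

theorem orderBuchsbaum (h : TangentConePresentation n φ M) (hlt : StrictMono n)
    (hB : IsBuchsbaum M) : OrderBuchsbaum (n 0) (n 1) (n 2) := by
  intro p q r N _ hN
  have h1 : φ (MvPolynomial.X 0) ^ N *
      φ (MvPolynomial.monomial (expVec p q r) 1) = 0 := by
    rw [X_pow_mul_monomial, h.monomial_eq_zero_iff, longFactorization_iff, map_add,
      map_add, expWeight_expVec, degree_expVec, expWeight_single, Finsupp.degree_single]
    convert hN using 1 <;> ring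
  have h2 : ∀ i, LongSum (n 0) (n 1) (n 2) (p * n 0 + q * n 1 + r * n 2 + n i) (p + q + r + 2) := by
    intro i
    have h3 := h.X_mul_eq_zero_of_isBuchsbaum hlt hB h1 i
    rw [← pow_one (φ (MvPolynomial.X i)), X_pow_mul_monomial,
      h.monomial_eq_zero_iff, longFactorization_iff, map_add,
      map_add, expWeight_expVec, degree_expVec, expWeight_single, Finsupp.degree_single] at h3
    convert h3 using 1 <;> ring
  exact ⟨h2 0, h2 1, h2 2⟩

/-- The localization at M has positive dimension, so a maximal regular sequence is nonempty and its
first term forces `H⁰_M` to vanish. In dimension 0 some X^N f with f(0) ≠ 0 would vanish, giving N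
n_0 a factorization longer than N although n_0 is the least generator. -/
theorem localCohomologyZero_eq_bot_of_isCohenMacaulayRing (h : TangentConePresentation n φ M)
    (hlt : StrictMono n) (hCM : IsCohenMacaulayRing A) : localCohomologyZero M = ⊥ := by
  have hM := h.isMaximal
  obtain ⟨-, rs, hmem, hreg, hlen⟩ := hCM.2 M
  obtain _ | ⟨u, rs⟩ := rs
  · exfalso
    have h1 : Ring.KrullDimLE 0 (Localization.AtPrime M) :=
      ringKrullDimZero_iff_ringKrullDim_eq_zero.2 (by simpa using hlen.symm)
    have h2 : algebraMap A (Localization.AtPrime M) (φ (MvPolynomial.X 0)) ∈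
        IsLocalRing.maximalIdeal (Localization.AtPrime M) := by
      rw [IsLocalization.AtPrime.to_map_mem_maximal_iff _ M,
        h.mem_iff, MvPolynomial.constantCoeff_X]
    rw [← Ring.KrullDimLE.nilradical_eq_maximalIdeal] at h2
    obtain ⟨N, hN⟩ := h2
    rw [← map_pow, Ideal.zero_eq_bot, Ideal.mem_bot,
      IsLocalization.map_eq_zero_iff M.primeCompl] at hN
    obtain ⟨⟨w, hw⟩, hwN⟩ := hN
    obtain ⟨f, rfl⟩ := h.surjective w
    have hf : MvPolynomial.constantCoeff f ≠ 0 := fun h0 =>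
      hw ((h.mem_iff f).2 h0)
    have h3 : φ (MvPolynomial.X 0 ^ N * f) = 0 := by
      rw [map_mul, map_pow, mul_comm]
      exact hwN
    rw [h.eq_zero_iff] at h3
    have h4 := h3 N (N * n 0) (by rwa [bigradedCoeff_X_pow_mul])
    rw [longFactorization_iff] at h4
    obtain ⟨p, q, r, h5, h6⟩ := h4
    have h01 : (n 0 : ℕ) < n 1 := (PNat.coe_lt_coe _ _).2 (hlt (by decide))
    have h02 : (n 0 : ℕ) < n 2 := (PNat.coe_lt_coe _ _).2 (hlt (by decide))
    have h7 : q * (n 0 : ℕ) ≤ q * n 1 := Nat.mul_le_mul_left _ h01.le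
    have h8 : r * (n 0 : ℕ) ≤ r * n 2 := Nat.mul_le_mul_left _ h02.le
    have h9 : (N + 1) * (n 0 : ℕ) ≤ (p + q + r) * n 0 := Nat.mul_le_mul_right _ h6
    have h10 := (n 0).pos
    linarith
  · rw [RingTheory.Sequence.isRegular_cons_iff] at hreg
    exact localCohomologyZero_eq_bot M (hmem u (by simp)) hreg.1

theorem isBuchsbaum_of_isCohenMacaulayRing (h : TangentConePresentation n φ M)
    (hlt : StrictMono n) (hCM : IsCohenMacaulayRing A) : IsBuchsbaum M := by
  rw [IsBuchsbaum, IsKBuchsbaum, h.localCohomologyZero_eq_bot_of_isCohenMacaulayRing hlt hCM,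
    Ideal.mul_bot]

theorem X_mem_nonZeroDivisors (h : TangentConePresentation n φ M)
    (hR : OrderRegular (n 0) (n 1) (n 2)) : φ (MvPolynomial.X 0) ∈ nonZeroDivisors A := by
  rw [mem_nonZeroDivisors_iff_right]
  intro a ha
  obtain ⟨f, rfl⟩ := h.surjective a
  rw [mul_comm, ← map_mul, h.eq_zero_iff] at ha
  rw [h.eq_zero_iff]
  intro e s hes
  have h1 := ha (e + 1) (s + n 0) (by rwa [bigradedCoeff_X_mul])
  obtain ⟨a, -, rfl, rfl⟩ := exists_of_bigradedCoeff_ne_zero k n hes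
  rw [← expVec_eta a, expWeight_expVec, degree_expVec, longFactorization_iff] at h1 ⊢
  exact hR _ _ _ h1

variable (φ) in
/-- The restriction of `φ` to the polynomials in the first variable. -/
noncomputable def parameter : Polynomial k →+* A :=
  φ.comp (Polynomial.eval₂RingHom MvPolynomial.C (MvPolynomial.X 0))

theorem parameter_X : parameter φ Polynomial.X = φ (MvPolynomial.X 0) := by
  simp [parameter]

theorem parameter_C (c : k) : parameter φ (Polynomial.C c) = φ (MvPolynomial.C c) := by
  simp [parameter]

/-- Nilpotents vanish modulo a prime, so Y and Z disappear and the quotient is generated by X over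
k. -/
theorem exists_sub_parameter_mem (h : TangentConePresentation n φ M) (hlt : StrictMono n)
    (P : Ideal A) [hP : P.IsPrime] (a : A) : ∃ p, a - parameter φ p ∈ P := by
  obtain ⟨f, rfl⟩ := h.surjective a
  induction f using MvPolynomial.induction_on with
  | C c => exact ⟨Polynomial.C c, by rw [parameter_C, sub_self]; exact zero_mem _⟩
  | add f g hf hg =>
    obtain ⟨p, hp⟩ := hf
    obtain ⟨q, hq⟩ := hg
    exact ⟨p + q, by rw [map_add, map_add, add_sub_add_comm]; exact add_mem hp hq⟩
  | mul_X f i hf =>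
    obtain ⟨p, hp⟩ := hf
    by_cases hi : i = 0
    · subst hi
      refine ⟨p * Polynomial.X, ?_⟩
      rw [map_mul, map_mul, parameter_X, ← sub_mul]
      exact P.mul_mem_right _ hp
    · refine ⟨0, ?_⟩
      rw [map_mul, map_zero, sub_zero]
      refine P.mul_mem_left _ (hP.mem_of_pow_mem (n 0) ?_)
      rw [h.X_pow_eq_zero (hlt.lt_of_ne_zero hi)]
      exact zero_mem _

/-- Write p = X^v q with q(0) ≠ 0. If q(X)a = 0, solving for the constant term shows that a is X
times a multiple of itself, hence 0. -/
theorem parameter_mem_nonZeroDivisors (h : TangentConePresentation n φ M)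
    (hR : OrderRegular (n 0) (n 1) (n 2)) {p : Polynomial k} (hp : p ≠ 0) :
    parameter φ p ∈ nonZeroDivisors A := by
  obtain ⟨q, hpq, hq⟩ := Polynomial.exists_eq_pow_rootMultiplicity_mul_and_not_dvd p hp 0
  rw [Polynomial.C_0, sub_zero] at hpq hq
  rw [hpq, map_mul, map_pow, parameter_X]
  refine mul_mem (pow_mem (h.X_mem_nonZeroDivisors hR) _) ?_
  rw [mem_nonZeroDivisors_iff_right]
  intro a ha
  have hc : q.coeff 0 ≠ 0 := fun h0 => hq (Polynomial.X_dvd_iff.2 h0)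
  rw [← Polynomial.divX_mul_X_add q, map_add, map_mul, parameter_X,
    parameter_C] at ha
  have hinv : φ (MvPolynomial.C (q.coeff 0)) *
      φ (MvPolynomial.C (q.coeff 0)⁻¹) = 1 := by
    rw [← map_mul, ← map_mul, mul_inv_cancel₀ hc, map_one, map_one]
  refine h.eq_zero_of_eq_X_mul 0 (v := -(parameter φ q.divX *
    φ (MvPolynomial.C (q.coeff 0)⁻¹))) ?_
  linear_combination φ (MvPolynomial.C (q.coeff 0)⁻¹) * ha - a * hinv

theorem isCohenMacaulayRing (h : TangentConePresentation n φ M) (hlt : StrictMono n)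
    (hR : OrderRegular (n 0) (n 1) (n 2)) : IsCohenMacaulayRing A := by
  have := h.isNoetherianRing
  refine ⟨inferInstance, fun P hP => ?_⟩
  -- When X is not in P, its inverse modulo P is represented by a polynomial f in X, and p = fX - 1
  -- works.
  obtain ⟨p, hp0, hp⟩ : ∃ p : Polynomial k, p ≠ 0 ∧ parameter φ p ∈ P := by
    by_cases hX : φ (MvPolynomial.X 0) ∈ P
    · exact ⟨Polynomial.X, Polynomial.X_ne_zero, by rwa [parameter_X]⟩
    · obtain ⟨a, b, hb, hab⟩ := hP.exists_inv hX
      obtain ⟨f, hf⟩ := h.exists_sub_parameter_mem hlt P a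
      refine ⟨f * Polynomial.X - 1, ?_, ?_⟩
      · intro h0
        have := congrArg (fun g => Polynomial.coeff g 0) h0
        simp at this
      · have h1 := add_mem (P.mul_mem_right (φ (MvPolynomial.X 0)) hf) hb
        rw [map_sub, map_mul, map_one, parameter_X, ← neg_mem_iff]
        convert h1 using 1
        rw [← hab]
        ring
  refine isCohenMacaulayLocalRing_of_mem_minimalPrimes P
    (h.parameter_mem_nonZeroDivisors hR hp0) ⟨⟨hP.isPrime, ?_⟩, ?_⟩
  · rw [Ideal.span_singleton_le_iff_mem]
    exact hp
  -- A prime Q inside P containing p(X) contracts to a nonzero prime of k[T], which is maximal; so Q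
  -- and P have the same contraction, and every element is congruent modulo Q to a polynomial in X.
  · rintro Q ⟨hQ, hpQ⟩ hQP a ha
    rw [Ideal.span_singleton_le_iff_mem] at hpQ
    obtain ⟨f, hf⟩ := h.exists_sub_parameter_mem hlt Q a
    have h1 : (Q.comap (parameter φ)).IsMaximal := by
      refine IsPrime.to_maximal_ideal fun h0 => hp0 ?_
      rw [← Ideal.mem_bot, ← h0]
      exact hpQ
    have h2 : Q.comap (parameter φ) = P.comap (parameter φ) :=
      h1.eq_of_le (Ideal.IsPrime.ne_top inferInstance) (Ideal.comap_mono hQP)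
    have h3 : f ∈ P.comap (parameter φ) := by
      rw [Ideal.mem_comap]
      simpa using sub_mem ha (hQP hf)
    rw [← h2] at h3
    simpa using add_mem hf h3

end TangentConePresentation

end ThreeGeneratedTangentCone

/-! ### Transfer to the initial form ideal and conclusion. -/

theorem exists_generators_initialFormIdeal {k : Type*} [Field k] (n : Fin 3 → ℕ+) {c : ℕ}
    (h : ∃ s : Finset (MvPolynomial (Fin 3) k), s.card ≤ c ∧
      Ideal.span (s : Set (MvPolynomial (Fin 3) k)) = RingHom.ker (tangentConeEval k n)) :
    ∃ s : Finset (AssocGraded (IsLocalRing.maximalIdeal (MvPowerSeries (Fin 3) k))),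
      s.card ≤ c ∧ Ideal.span (s : Set _) = initialFormIdeal k n := by
  classical
  obtain ⟨s, hs, hspan⟩ := h
  refine ⟨s.image (powerSeriesGradedEval k), Finset.card_image_le.trans hs, ?_⟩
  rw [initialFormIdeal_eq_map, ← hspan, Ideal.map_span, Finset.coe_image]

/-- A Buchsbaum tangent cone is Cohen–Macaulay or given by the exceptional relations. -/
theorem orderRegular_or_exceptionalRelations {k : Type*} [Field k] {n : Fin 3 → ℕ+}
    (hlt : StrictMono n)
    (hmin : ∀ i, (n i : ℕ) ∉ AddSubmonoid.closure ((fun j => (n j : ℕ)) '' {i}ᶜ))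
    (hB : IsBuchsbaum (A := TangentCone k n) (homogMaxIdeal (NumSemigroupRing k n))) :
    OrderRegular (n 0) (n 1) (n 2) ∨
      ∃ a b m, ExceptionalRelations (n 0) (n 1) (n 2) a b m := by
  by_cases hR : OrderRegular (n 0) (n 1) (n 2)
  · exact Or.inl hR
  have hcomb : ∀ i j l : Fin 3, j ≠ i → l ≠ i → ∀ u v, (n i : ℕ) ≠ u * n j + v * n l := by
    intro i j l hj hl u v h
    refine hmin i ?_
    rw [h, ← smul_eq_mul, ← smul_eq_mul]
    exact add_mem (nsmul_mem (AddSubmonoid.subset_closure (Set.mem_image_of_mem _ hj)) u)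
      (nsmul_mem (AddSubmonoid.subset_closure (Set.mem_image_of_mem _ hl)) v)
  exact Or.inr (((tangentConePresentation k n).orderBuchsbaum hlt hB).exceptionalRelations (n 0).pos
    ((PNat.coe_lt_coe _ _).2 (hlt (by decide))) ((PNat.coe_lt_coe _ _).2 (hlt (by decide)))
    (hcomb 1 0 2 (by decide) (by decide)) (hcomb 2 0 1 (by decide) (by decide)) hR)

theorem mainTheorem6 {k : Type*} [Field k] [CharZero k] (n : Fin 3 → ℕ+)
    (hlt : StrictMono n)
    (hgcd : Finset.univ.gcd (fun i => (n i : ℕ)) = 1)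
    (hmin : ∀ i, (n i : ℕ) ∉ AddSubmonoid.closure ((fun j => (n j : ℕ)) '' {i}ᶜ)) :
    (IsBuchsbaum (A := TangentCone k n) (homogMaxIdeal (NumSemigroupRing k n)) →
      ∃ s : Finset (AssocGraded (IsLocalRing.maximalIdeal (MvPowerSeries (Fin 3) k))),
        s.card ≤ 4 ∧ Ideal.span (s : Set _) = initialFormIdeal k n) ∧
    (IsGorensteinLocalRing (NumSemigroupRing k n) →
      (IsCohenMacaulayRing (TangentCone k n) ↔
        IsBuchsbaum (A := TangentCone k n) (homogMaxIdeal (NumSemigroupRing k n)))) := by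
  refine ⟨fun hB => exists_generators_initialFormIdeal n ?_, fun hG => ⟨fun hCM =>
    (tangentConePresentation k n).isBuchsbaum_of_isCohenMacaulayRing hlt hCM, fun hB => ?_⟩⟩
  · obtain hR | ⟨a, b, m, h⟩ := orderRegular_or_exceptionalRelations hlt hmin hB
    · obtain ⟨s, hs, hspan⟩ := hR.exists_generators k n (hlt (by decide)) (hlt (by decide))
      exact ⟨s, hs.trans (by norm_num), hspan⟩
    · exact h.exists_generators k n
  · obtain hR | ⟨a, b, m, h⟩ := orderRegular_or_exceptionalRelations hlt hmin hB
    · exact (tangentConePresentation k n).isCohenMacaulayRing hlt hR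
    · obtain ⟨f, f', hf, hf', hne⟩ := h.exists_pseudoFrobenius
      exact absurd (hG.pseudoFrobenius_unique k 0 hgcd hf hf') hne
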